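/- **Conventions.** Let $k$ be a commutative ring and $\mathcal C$ a DG-category over $k$. A *twisted complex* over $\mathcal C$ is a finite family of objects $E_a$ in positions $\deg a\in\mathbb Z$ (a formal direct sum in each position) with morphisms $\alpha_{ab}:E_a\to E_b$ of degree $\deg a-\deg b+1$ such that $(-1)^{\deg b}d\alpha_{ab}+\sum_c\alpha_{cb}\alpha_{ac}=0$; it is *one-sided* if $\alpha_{ab}=0$ whenever $\deg a\ge\deg b$. Twisted complexes form a DG-category: a morphism of degree $p$ is a matrix $\gamma=(\gamma_{ab})$ with $\gamma_{ab}:E_a\to F_b$ of degree $p+\deg a-\deg b$, and $$(d\gamma)_{ab}=(-1)^{\deg b}d\gamma_{ab}+\sum_c\beta_{cb}\gamma_{ac}-(-1)^{p}\sum_c\gamma_{cb}\alpha_{ac}.$$ An object of $\mathcal C$ is regarded as a twisted complex in position $0$. $\mathcal C$ is *pretriangulated* (resp. *strongly pretriangulated*) if every one-sided twisted complex is homotopy equivalent (resp. isomorphic by a closed isomorphism of degree $0$) to an object of $\mathcal C$, called its convolution. For a closed morphism $\varphi:E\to F$ of degree $0$ let $(E\xrightarrow{\varphi}F)$ be the twisted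 complex consisting of $E$ moved down by one position with twisted map $-\alpha$, of $F$, and of $\varphi$; it has a canonical morphism $F\to(E\to F)$ of degree $0$ and a canonical morphism $(E\to F)\to E$ of degree $1$ (i.e. to $E[1]$), both given by identities. Closed morphisms $A\to B\to T\to A$ of degrees $0,0,1$ in $\mathcal C$ form an exact triangle in $H^0(\mathcal C)$ if they are isomorphic, in the homotopy category of twisted complexes, to such a triangle $E\to F\to(E\to F)\to E[1]$. For a finite set $S$ order $\{-1,0\}^S$ componentwise and put $|i|=\sum_s i_s$. A *twisted cube* $X=(X_i,q_{ij})$ over $\mathcal C$ indexed by $\{-1,0\}^S$ consists of objects $X_i$ and, for $i<j$, morphisms $q_{ij}:X_i\to X_j$ of degree $|i|-|j|+1$ with $$(-1)^{|j|}dq_{ij}+\sum_{i<m<j}q_{mj}q_{im}=0 .$$ For $m\in\{-1,0,1\}^S$ let $m'$ be the restriction of $m$ to the directions in which $m$ is not $1$, and $|m'|$ the sum of its coordinates. The *sign-twisted subcube* $Y^m$ consists of the $X_i$ with $i$ restricting to $m'$ and of the morphisms $(-1)^{|m'|}q_{ij}$ between them. We also write $Y^m$ for its total complex, the one-sided twisted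 complex in which $X_i$ has position $|i|-|m'|$. A *row* of $\{-1,0,1\}^S$ is a triple $l\to m\to n$ of vertices that agree except in one direction, in which they are $-1,0,1$. For a row let $\alpha:Y^l\to Y^m$ be the morphism with entries $(-1)^{|n'|}q_{ij}$. **Lemma (Cube Completion Lemma).** Let $\mathcal C$ be pretriangulated and let $X$ be a twisted $n$-cube over $\mathcal C$, i.e. $S=\{1,\dots,n\}$. For every row, $\alpha$ is closed of degree $0$, and the identities of the $X_i$ give mutually inverse closed isomorphisms of degree $0$ between $(Y^l\xrightarrow{\alpha}Y^m)$ and $Y^n$. There is a diagram $Z=(Z_m,r_{mn})$ in $\mathcal C$ indexed by $M=\{-1,0,1\}^n$, together with homotopy equivalences $\theta_m:Z_m\to Y^m$ of twisted complexes, such that: 1. (Objects) via $\theta_m$, the object $Z_m$ is the convolution of the sign-twisted subcube $Y^m$. 2. (Morphisms) For every row $l\to m\to n$ there are in $Z$ closed morphisms $$Z_l\xrightarrow{r_{lm}}Z_m\xrightarrow{r_{mn}}Z_n\xrightarrow{r_{nl}}Z_l[1]$$ (where $r_{nl}$ is regarded as a morphism $Z_n\to Z_l$ of degree $1$) which correspond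 under $\theta$, up to homotopy, to $$Y^l\xrightarrow{\alpha}Y^m\to(Y^l\xrightarrow{\alpha}Y^m)\cong Y^n\to Y^l[1].$$ 3. All morphisms of $Z$ that do not occur in such a row are $0$. The pair $(Z,\theta)$ is unique in the following sense. If $(Z',\theta')$ is another such pair, there are homotopy equivalences $\varphi_m:Z_m\to Z'_m$ with $\theta'_m\varphi_m\sim\theta_m$; they satisfy $\varphi_m r_{lm}\sim r'_{lm}\varphi_l$ for all $l,m\in M$, and each $\varphi_m$ is unique up to homotopy among closed morphisms of degree $0$ with $\theta'_m\varphi_m\sim\theta_m$. Moreover, for every such $(Z,\theta)$: 4. (Rows) The image of every row $Z_l\to Z_m\to Z_n\to Z_l[1]$ in $H^0(\mathcal C)$ is an exact triangle. 5. (Recursivity) Let $\{1,\dots,n\}=J\sqcup K$, and for $\kappa\in\{-1,0\}^K$ (or in $\{-1,0,1\}^K$) write $(1,\kappa)$ for the vertex that is $\kappa$ on $K$ and $1$ on $J$. Then the twisted complexes $Y^{(1,\kappa)}$, $\kappa\in\{-1,0\}^K$, with the morphisms $Y^{(1,\kappa)}\to Y^{(1,\lambda)}$, $\kappa<\lambda$,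 whose entries are the $q_{ij}$, form a twisted cube $Y$ indexed by $\{-1,0\}^K$ over the DG-category of twisted complexes over $\mathcal C$. The subcube $(Z_{(1,m)})_{m\in\{-1,0,1\}^K}$ of $Z$, with the maps having the same components as $\theta_{(1,m)}$, satisfies 1--3 for $Y$. 6. (Commutativity) The image of $Z$ in $H^0(\mathcal C)$ commutes up to isomorphisms $\pm\mathrm{id}$: the compositions along any two paths in $Z$ along the rows (including the wrap-around arrows $Z_n\to Z_l[1]$) with the same ends and the same degree are homotopic up to a sign. If $\mathcal C$ is strongly pretriangulated, the same holds on the nose: all of the above is true with closed isomorphisms of degree $0$ in place of homotopy equivalences and with equalities in place of homotopies in 1, 2, 5 and in the uniqueness statement. -/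

import Mathlib

universe v u w

/-- A DG-category over a commutative ring `k`. The complex of morphisms `X ⟶ Y` is encoded as a
`k`-module `Hom X Y` that is the internal direct sum of its homogeneous parts `gr X Y p`
(`p : ℤ`), with a differential of degree `1`. The composition `comp g f` is "`f`, then `g`". -/
class DGCategory (k : Type w) [CommRing k] (C : Type u) where
  Hom : C → C → Type v
  [addCommGroup : ∀ X Y, AddCommGroup (Hom X Y)]
  [module : ∀ X Y, Module k (Hom X Y)]
  /-- the homogeneous morphisms of a given degree -/
  gr : ∀ X Y, ℤ → Submodule k (Hom X Y)
  isInternal : ∀ X Y, DirectSum.IsInternal (gr X Y)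
  id : ∀ X, Hom X X
  comp : ∀ {X Y Z}, Hom Y Z →ₗ[k] Hom X Y →ₗ[k] Hom X Z
  d : ∀ {X Y}, Hom X Y →ₗ[k] Hom X Y
  id_mem : ∀ X, id X ∈ gr X X 0
  comp_mem : ∀ {X Y Z} {p q : ℤ} {g : Hom Y Z} {f : Hom X Y},
    g ∈ gr Y Z p → f ∈ gr X Y q → comp g f ∈ gr X Z (p + q)
  d_mem : ∀ {X Y} {p : ℤ} {f : Hom X Y}, f ∈ gr X Y p → d f ∈ gr X Y (p + 1)
  id_comp : ∀ {X Y} (f : Hom X Y), comp (id Y) f = f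
  comp_id : ∀ {X Y} (f : Hom X Y), comp f (id X) = f
  assoc : ∀ {W X Y Z} (h : Hom Y Z) (g : Hom X Y) (f : Hom W X),
    comp (comp h g) f = comp h (comp g f)
  d_d : ∀ {X Y} (f : Hom X Y), d (d f) = 0
  /-- the graded Leibniz rule -/
  d_comp : ∀ {X Y Z} {p : ℤ} {g : Hom Y Z} (f : Hom X Y), g ∈ gr Y Z p →
    d (comp g f) = comp (d g) f + ((p.negOnePow : ℤ) : k) • comp g (d f)

namespace DGCategory

attribute [reducible] DGCategory.addCommGroup DGCategory.module
attribute [instance] DGCategory.addCommGroup DGCategory.module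

/-- The sign `(-1)^p` as a scalar. -/
def sgn (k : Type w) [CommRing k] (p : ℤ) : k := ((p.negOnePow : ℤ) : k)

section sgn
variable (k : Type w) [CommRing k]

theorem sgn_add (p q : ℤ) : sgn k (p + q) = sgn k p * sgn k q := by
  simp [sgn, Int.negOnePow_add]

theorem sgn_neg (p : ℤ) : sgn k (-p) = sgn k p := by
  simp [sgn, Int.negOnePow_neg]

theorem sgn_sub (p q : ℤ) : sgn k (p - q) = sgn k p * sgn k q := by
  rw [sub_eq_add_neg, sgn_add, sgn_neg]

theorem sgn_zero : sgn k 0 = 1 := by simp [sgn]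

theorem sgn_one : sgn k 1 = -1 := by simp [sgn]

theorem sgn_mul_self (p : ℤ) : sgn k p * sgn k p = 1 := by
  rcases Int.even_or_odd p with h | h
  · simp [sgn, Int.negOnePow_even _ h]
  · simp [sgn, Int.negOnePow_odd _ h]

end sgn

section basics
variable (k : Type w) [CommRing k] {C : Type u} [DGCategory.{v} k C]

theorem hom_induction {X Y : C} {P : Hom k X Y → Prop} (f : Hom k X Y)
    (hom : ∀ (p : ℤ) (f : Hom k X Y), f ∈ gr (k := k) X Y p → P f)
    (add : ∀ f g, P f → P g → P (f + g)) : P f := by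
  have h : f ∈ iSup (gr (k := k) X Y) := by
    rw [(isInternal (k := k) X Y).submodule_iSup_eq_top]; trivial
  exact Submodule.iSup_induction _ (motive := P) h hom (hom 0 0 (Submodule.zero_mem _)) add

/-- The grading involution `f ↦ (-1)^(deg f) f` on morphisms. -/
noncomputable def par {X Y : C} : Hom k X Y →ₗ[k] Hom k X Y :=
  (DirectSum.toModule k ℤ (Hom k X Y) fun p => sgn k p • (gr (k := k) X Y p).subtype) ∘ₗ
    (LinearEquiv.ofBijective (DirectSum.coeLinearMap (gr (k := k) X Y))
      (isInternal (k := k) X Y)).symm.toLinearMap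

theorem par_of_mem {X Y : C} {p : ℤ} {f : Hom k X Y} (hf : f ∈ gr (k := k) X Y p) :
    par k f = sgn k p • f := by
  have h : (LinearEquiv.ofBijective (DirectSum.coeLinearMap (gr (k := k) X Y))
      (isInternal (k := k) X Y)).symm f = DirectSum.lof k ℤ (fun p => gr (k := k) X Y p) p ⟨f, hf⟩ := by
    rw [LinearEquiv.symm_apply_eq]
    exact (DirectSum.coeLinearMap_lof (gr (k := k) X Y) p ⟨f, hf⟩).symm
  simp [par, h]

theorem par_par {X Y : C} (f : Hom k X Y) : par k (par k f) = f := by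
  induction f using hom_induction (k := k) with
  | hom p f hf => simp [par_of_mem k hf, smul_smul, sgn_mul_self]
  | add f g hf hg => simp [hf, hg]

theorem par_d {X Y : C} (f : Hom k X Y) : par k (d (k := k) f) = - d (k := k) (par k f) := by
  induction f using hom_induction (k := k) with
  | hom p f hf => simp [par_of_mem k hf, par_of_mem k (d_mem hf), sgn_add, sgn_one]
  | add f g hf hg => simp only [map_add, hf, hg]; abel

theorem par_comp {X Y Z : C} (g : Hom k Y Z) (f : Hom k X Y) :
    par k (comp (k := k) g f) = comp (k := k) (par k g) (par k f) := by
  induction g using hom_induction (k := k) with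
  | hom p g hg =>
    induction f using hom_induction (k := k) with
    | hom q f hf =>
      simp [par_of_mem k hg, par_of_mem k hf, par_of_mem k (comp_mem hg hf), sgn_add, smul_smul,
        mul_comm]
    | add f g hf hg => simp only [map_add, hf, hg]
  | add f g hf hg => simp only [map_add, LinearMap.add_apply, hf, hg]

theorem d_comp_par {X Y Z : C} (g : Hom k Y Z) (f : Hom k X Y) :
    d (k := k) (comp (k := k) g f) =
      comp (k := k) (d (k := k) g) f + comp (k := k) (par k g) (d (k := k) f) := by
  induction g using hom_induction (k := k) with
  | hom p g hg => rw [d_comp f hg, par_of_mem k hg]; simp [sgn]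
  | add f g hf hg => simp only [map_add, LinearMap.add_apply, hf, hg]; abel

/-- The morphism between equal objects given by the identity. -/
def ofEq {X Y : C} (h : X = Y) : Hom k X Y := h ▸ id (k := k) X

end basics

/-! ### Twisted complexes -/

/-- A formal finite direct sum `⨁ i, obj i` of objects of `C`, the summand `obj i` being placed
in position `deg i`. The morphisms are the matrices of morphisms of `C`. -/
structure Fam (C : Type u) where
  ι : Type
  [fintype : Fintype ι]
  deg : ι → ℤ
  obj : ι → C

attribute [instance] Fam.fintype

namespace Fam

section
variable (k : Type w) [CommRing k] {C : Type u} [DGCategory.{v} k C]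

/-- Matrices of morphisms. -/
abbrev Mat (E F : Fam C) : Type v := ∀ (i : E.ι) (j : F.ι), Hom k (E.obj i) (F.obj j)

/-- An entry of degree `q` from position `a` to position `b` has total degree `q + b - a`. -/
def matGr (E F : Fam C) (p : ℤ) : Submodule k (Mat k E F) where
  carrier := {γ | ∀ i j, γ i j ∈ gr (k := k) (E.obj i) (F.obj j) (p + E.deg i - F.deg j)}
  add_mem' ha hb i j := Submodule.add_mem _ (ha i j) (hb i j)
  zero_mem' _ _ := Submodule.zero_mem _
  smul_mem' c _ ha i j := Submodule.smul_mem _ c (ha i j)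

/-- Matrix multiplication. -/
def matComp {E F G : Fam C} : Mat k F G →ₗ[k] Mat k E F →ₗ[k] Mat k E G :=
  LinearMap.mk₂ k (fun g f i j => ∑ m, comp (k := k) (g m j) (f i m))
    (by intros; ext i j; simp [Finset.sum_add_distrib])
    (by intros; ext i j; simp [Finset.smul_sum])
    (by intros; ext i j; simp [Finset.sum_add_distrib])
    (by intros; ext i j; simp [Finset.smul_sum])

/-- The entrywise differential, with the sign `(-1)^b` on entries ending in position `b`. -/
def matD {E F : Fam C} : Mat k E F →ₗ[k] Mat k E F where
  toFun γ i j := sgn k (F.deg j) • d (k := k) (γ i j)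
  map_add' _ _ := by ext i j; simp
  map_smul' c _ := by ext i j; simp [smul_smul, mul_comm]

open Classical in
/-- The identity matrix. -/
noncomputable def matId (E : Fam C) : Mat k E E :=
  fun i j => if h : i = j then ofEq k (congrArg E.obj h) else 0

theorem matComp_apply {E F G : Fam C} (g : Mat k F G) (f : Mat k E F) (i : E.ι) (j : G.ι) :
    matComp k g f i j = ∑ m, comp (k := k) (g m j) (f i m) := rfl

theorem matD_apply {E F : Fam C} (f : Mat k E F) (i : E.ι) (j : F.ι) :
    matD k f i j = sgn k (F.deg j) • d (k := k) (f i j) := rfl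

theorem matId_self (E : Fam C) (i : E.ι) : matId k E i i = id (k := k) (E.obj i) := by
  simp [matId, ofEq]

theorem matId_ne (E : Fam C) {i j : E.ι} (h : i ≠ j) : matId k E i j = 0 := by
  simp [matId, h]

theorem matGr_isInternal (E F : Fam C) : DirectSum.IsInternal (matGr k E F) := by
  classical
  apply DirectSum.isInternal_submodule_of_iSupIndep_of_iSup_eq_top
  · rw [iSupIndep_iff_finsetSum_eq_zero_imp_eq_zero]
    intro s x hx hs p hp
    ext i j
    have hI := (isInternal (k := k) (E.obj i) (F.obj j)).submodule_iSupIndep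
    have hI' := hI.comp (f := fun p : ℤ => p + E.deg i - F.deg j)
      (fun a b h => by simpa using h)
    rw [iSupIndep_iff_finsetSum_eq_zero_imp_eq_zero] at hI'
    refine hI' s (fun p => x p i j) (fun p hp => hx p hp i j) ?_ p hp
    have := congrFun (congrFun hs i) j
    simpa [Finset.sum_apply] using this
  · rw [eq_top_iff]
    rintro γ -
    have h1 : γ = ∑ i, Pi.single i (∑ j, Pi.single j (γ i j)) := by
      ext i j
      rw [Finset.sum_apply, Finset.sum_eq_single i, Pi.single_eq_same, Finset.sum_apply,
        Finset.sum_eq_single j, Pi.single_eq_same]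
      · intro b _ hb; rw [Pi.single_eq_of_ne (Ne.symm hb)]
      · simp
      · intro b _ hb; rw [Pi.single_eq_of_ne (Ne.symm hb)]
      · simp
    have key : ∀ (i : E.ι) (j : F.ι) (f : Hom k (E.obj i) (F.obj j)),
        (Pi.single i (Pi.single j f : ∀ j, Hom k (E.obj i) (F.obj j)) : Mat k E F) ∈
          iSup (matGr k E F) := by
      intro i j f
      induction f using hom_induction (k := k) with
      | hom q f hf =>
        refine Submodule.mem_iSup_of_mem (q - E.deg i + F.deg j) ?_
        intro i' j'
        by_cases hi : i' = i
        · subst hi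
          by_cases hj : j' = j
          · subst hj
            have h3 : q - E.deg i' + F.deg j' + E.deg i' - F.deg j' = q := by ring
            simp only [Pi.single_eq_same]
            rw [h3]
            exact hf
          · simp [hj]
        · simp [hi]
      | add f g hf hg => rw [Pi.single_add, Pi.single_add]; exact Submodule.add_mem _ hf hg
    rw [h1]
    refine Submodule.sum_mem _ fun i _ => ?_
    rw [← LinearMap.single_apply (R := k), map_sum]
    exact Submodule.sum_mem _ fun j _ => key i j (γ i j)

/-- The DG-category of formal sums of objects of `C` in prescribed positions. -/
noncomputable instance : DGCategory.{v} k (Fam C) where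
  Hom := Mat k
  gr := matGr k
  isInternal := matGr_isInternal k
  id := matId k
  comp := matComp k
  d := matD k
  id_mem E i j := by
    by_cases h : i = j
    · subst h; rw [matId_self]; simpa using id_mem (k := k) (E.obj i)
    · rw [matId_ne k E h]; exact Submodule.zero_mem _
  comp_mem {E F G p q g f} hg hf i j := by
    refine Submodule.sum_mem _ fun m _ => ?_
    have := comp_mem (hg m j) (hf i m)
    convert this using 1
    ring_nf
  d_mem {E F p f} hf i j := by
    refine Submodule.smul_mem _ _ ?_
    have := d_mem (hf i j)
    convert this using 1
    ring_nf
  id_comp {E F} f := by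
    ext i j
    rw [matComp_apply, Finset.sum_eq_single j]
    · rw [matId_self, id_comp]
    · intro b _ hb; rw [matId_ne k F hb]; simp
    · simp
  comp_id {E F} f := by
    ext i j
    rw [matComp_apply, Finset.sum_eq_single i]
    · rw [matId_self, comp_id]
    · intro b _ hb; rw [matId_ne k E hb.symm]; simp
    · simp
  assoc h g f := by
    ext i j
    simp only [matComp_apply, map_sum, LinearMap.sum_apply, assoc]
    exact Finset.sum_comm
  d_d f := by
    ext i j
    simp [matD_apply, d_d]
  d_comp {E F G p g} f hg := by
    ext i j
    simp only [matComp_apply, matD_apply, map_sum, Pi.add_apply, Pi.smul_apply, map_smul,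
      LinearMap.smul_apply, Finset.smul_sum, ← Finset.sum_add_distrib]
    refine Finset.sum_congr rfl fun m _ => ?_
    rw [d_comp _ (hg m j), smul_add, smul_smul, smul_smul]
    congr 2
    change sgn k _ * sgn k _ = sgn k _ * sgn k _
    rw [sgn_sub, sgn_add]
    linear_combination (sgn k p * sgn k (F.deg m)) * sgn_mul_self k (G.deg j)

end

end Fam

/-- A twisted complex over `C`, with `i`-th graded part the formal direct sum of the finitely many
`obj a` with `deg a = i`, and twisted maps `α a b` of degree `deg a - deg b + 1` such that
`(-1)^(deg b) d (α a b) + ∑ m, α m b ∘ α a m = 0`. -/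
structure TwistedComplex (k : Type w) [CommRing k] (C : Type u) [DGCategory.{v} k C]
    extends Fam C where
  α : ∀ a b : ι, Hom k (obj a) (obj b)
  α_mem : ∀ a b, α a b ∈ gr (k := k) (obj a) (obj b) (deg a - deg b + 1)
  maurerCartan : ∀ a b,
    sgn k (deg b) • d (k := k) (α a b) + ∑ m, comp (k := k) (α m b) (α a m) = 0

namespace TwistedComplex

section
variable (k : Type w) [CommRing k] {C : Type u} [DGCategory.{v} k C]

/-- The twisted map as an endomorphism of the underlying formal sum; it has degree `1`. -/
abbrev tw (E : TwistedComplex k C) : Hom k E.toFam E.toFam := E.α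

theorem tw_mem (E : TwistedComplex k C) : tw k E ∈ gr (k := k) E.toFam E.toFam 1 := by
  intro a b
  have := E.α_mem a b
  convert this using 1
  ring_nf

theorem tw_eq (E : TwistedComplex k C) :
    d (k := k) (tw k E) + comp (k := k) (tw k E) (tw k E) = 0 := by
  funext a b
  exact E.maurerCartan a b

/-- The differential on matrices `γ` from `E` to `F`:
`(dγ) a b = (-1)^(deg b) d (γ a b) + ∑ m, β m b ∘ γ a m - (-1)^(deg γ) ∑ m, γ m b ∘ α a m`. -/
noncomputable def twD {E F : TwistedComplex k C} :
    Hom k E.toFam F.toFam →ₗ[k] Hom k E.toFam F.toFam :=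
  d (k := k) + comp (k := k) (tw k F) -
    (LinearMap.flip (comp (k := k)) (tw k E)) ∘ₗ par k

theorem twD_apply {E F : TwistedComplex k C} (f : Hom k E.toFam F.toFam) :
    twD k f = d (k := k) f + comp (k := k) (tw k F) f - comp (k := k) (par k f) (tw k E) := rfl

theorem twD_twD {E F : TwistedComplex k C} (f : Hom k E.toFam F.toFam) :
    twD k (twD k f) = 0 := by
  have hE : d (k := k) (tw k E) = - comp (k := k) (tw k E) (tw k E) :=
    eq_neg_of_add_eq_zero_left (tw_eq k E)
  have hF : d (k := k) (tw k F) = - comp (k := k) (tw k F) (tw k F) :=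
    eq_neg_of_add_eq_zero_left (tw_eq k F)
  have pE : par k (tw k E) = - tw k E := by rw [par_of_mem k (tw_mem k E), sgn_one]; simp
  have pF : par k (tw k F) = - tw k F := by rw [par_of_mem k (tw_mem k F), sgn_one]; simp
  simp only [twD_apply, map_add, map_sub, d_comp_par, par_comp, par_par, par_d, d_d, hE, hF, pE, pF,
    LinearMap.neg_apply, map_neg, assoc]
  abel

theorem twD_comp {E F G : TwistedComplex k C} {p : ℤ} {g : Hom k F.toFam G.toFam}
    (f : Hom k E.toFam F.toFam) (hg : g ∈ gr (k := k) F.toFam G.toFam p) :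
    twD k (comp (k := k) g f) = comp (k := k) (twD k g) f + sgn k p • comp (k := k) g (twD k f) := by
  rw [← LinearMap.smul_apply, ← map_smul, ← par_of_mem k hg]
  simp only [twD_apply, map_add, map_sub, d_comp_par, par_comp,
    LinearMap.add_apply, LinearMap.sub_apply, assoc]
  abel

/-- The DG-category of twisted complexes over `C`. -/
noncomputable instance : DGCategory.{v} k (TwistedComplex k C) where
  Hom E F := Hom k E.toFam F.toFam
  gr E F := gr (k := k) E.toFam F.toFam
  isInternal E F := isInternal (k := k) E.toFam F.toFam
  id E := id (k := k) E.toFam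
  comp := comp (k := k)
  d := twD k
  id_mem E := id_mem (k := k) E.toFam
  comp_mem := comp_mem
  d_mem {E F p f} hf := by
    rw [twD_apply]
    refine Submodule.sub_mem _ (Submodule.add_mem _ (d_mem hf) ?_) ?_
    · rw [add_comm p 1]; exact comp_mem (tw_mem k F) hf
    · rw [par_of_mem k hf]
      exact comp_mem (Submodule.smul_mem _ _ hf) (tw_mem k E)
  id_comp := id_comp
  comp_id := comp_id
  assoc := assoc
  d_d := twD_twD k
  d_comp := twD_comp k

/-- The differential of a homogeneous morphism of twisted complexes, entry by entry. -/
theorem d_apply {E F : TwistedComplex k C} {p : ℤ} {f : Hom k E F}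
    (hf : f ∈ gr (k := k) E F p) (a : E.ι) (b : F.ι) :
    (d (k := k) f : Fam.Mat k E.toFam F.toFam) a b = sgn k (F.deg b) • d (k := k) (f a b) +
      ∑ m, comp (k := k) (F.α m b) (f a m) - sgn k p • ∑ m, comp (k := k) (f m b) (E.α a m) := by
  have h1 : par k (C := Fam C) f = sgn k p • f := par_of_mem (C := Fam C) k hf
  have h2 : twD k f = d (k := k) (C := Fam C) f + comp (k := k) (C := Fam C) (tw k F) f
      - sgn k p • comp (k := k) (C := Fam C) f (tw k E) := by
    rw [twD_apply, h1, map_smul, LinearMap.smul_apply]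
  have h3 : (d (k := k) f : Fam.Mat k E.toFam F.toFam) = twD k f := rfl
  rw [h3, h2]
  rfl

/-- A twisted complex is one-sided if its twisted maps strictly raise the position. -/
def IsOneSided (E : TwistedComplex k C) : Prop := ∀ a b, E.deg b ≤ E.deg a → E.α a b = 0

/-- An object of `C` as a twisted complex concentrated in position `0`. -/
def single (X : C) : TwistedComplex k C where
  ι := Unit
  deg _ := 0
  obj _ := X
  α _ _ := 0
  α_mem _ _ := Submodule.zero_mem _
  maurerCartan _ _ := by simp

/-- The embedding of `C` into twisted complexes, on morphisms. -/
def singleMap {X Y : C} (f : Hom k X Y) : Hom k (single k X) (single k Y) := fun _ _ => f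

/-- The total twisted complex `(E → F)`, with `F` in position `0`, of a closed morphism
`E → F` of degree `0`: the summands of `E` move down by one position and the twisted map of `E`
changes its sign. -/
def cone {E F : TwistedComplex k C} (f : Hom k E F) (hf : f ∈ gr (k := k) E F 0)
    (hd : d (k := k) f = 0) : TwistedComplex k C where
  ι := E.ι ⊕ F.ι
  deg := Sum.elim (fun a => E.deg a - 1) F.deg
  obj := Sum.elim E.obj F.obj
  α
    | .inl a, .inl b => - E.α a b
    | .inl a, .inr b => f a b
    | .inr _, .inl _ => 0
    | .inr a, .inr b => F.α a b
  α_mem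
    | .inl a, .inl b => by
      have h : E.deg a - 1 - (E.deg b - 1) + 1 = E.deg a - E.deg b + 1 := by ring
      exact h ▸ Submodule.neg_mem _ (E.α_mem a b)
    | .inl a, .inr b => by
      have h : E.deg a - 1 - F.deg b + 1 = 0 + E.deg a - F.deg b := by ring
      exact h ▸ hf a b
    | .inr _, .inl _ => Submodule.zero_mem _
    | .inr a, .inr b => F.α_mem a b
  maurerCartan
    | .inl a, .inl b => by
      have h := E.maurerCartan a b
      rw [Fintype.sum_sum_type]
      have h2 : sgn k (E.deg b - 1) • d (k := k) (-E.α a b) +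
          (∑ m, comp (k := k) (-E.α m b) (-E.α a m) +
            ∑ m, comp (k := k) (0 : Hom k (F.obj m) (E.obj b)) (f a m)) = 0 := by
        simpa [sgn_sub, sgn_one] using h
      exact h2
    | .inl a, .inr b => by
      have h := congrFun (congrFun hd a) b
      have h2 : par k (C := Fam C) f = f :=
        (par_of_mem (C := Fam C) k hf).trans (by rw [sgn_zero, one_smul])
      have h3 : twD k f = d (k := k) (C := Fam C) f + comp (k := k) (C := Fam C) (tw k F) f
        - comp (k := k) (C := Fam C) f (tw k E) := by rw [twD_apply, h2]
      have h4 : (twD k f : Fam.Mat k E.toFam F.toFam) a b = 0 := h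
      rw [h3] at h4
      have h5 : sgn k (F.deg b) • d (k := k) (f a b) + ∑ m, comp (k := k) (F.α m b) (f a m)
        - ∑ m, comp (k := k) (f m b) (E.α a m) = 0 := h4
      rw [Fintype.sum_sum_type]
      have h6 : sgn k (F.deg b) • d (k := k) (f a b) +
          (∑ m, comp (k := k) (f m b) (-E.α a m) + ∑ m, comp (k := k) (F.α m b) (f a m)) = 0 := by
        simp only [map_neg, Finset.sum_neg_distrib]
        rw [← h5]
        abel
      exact h6
    | .inr a, .inl b => by
      rw [Fintype.sum_sum_type]
      have h2 : sgn k (E.deg b - 1) • d (k := k) (0 : Hom k (F.obj a) (E.obj b)) +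
          (∑ m, comp (k := k) (-E.α m b) (0 : Hom k (F.obj a) (E.obj m)) +
            ∑ m, comp (k := k) (0 : Hom k (F.obj m) (E.obj b)) (F.α a m)) = 0 := by
        simp
      exact h2
    | .inr a, .inr b => by
      have h := F.maurerCartan a b
      rw [Fintype.sum_sum_type]
      have h2 : sgn k (F.deg b) • d (k := k) (F.α a b) +
          (∑ m, comp (k := k) (f m b) (0 : Hom k (F.obj a) (E.obj m)) +
            ∑ m, comp (k := k) (F.α m b) (F.α a m)) = 0 := by
        simpa using h
      exact h2

/-- The canonical morphism `F → (E → F)` of degree `0`, the identity on `F`. -/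
noncomputable def coneIn {E F : TwistedComplex k C} (f : Hom k E F) (hf : f ∈ gr (k := k) E F 0)
    (hd : d (k := k) f = 0) : Hom k F (cone k f hf hd)
  | _, .inl _ => 0
  | a, .inr b => id (k := k) F a b

/-- The canonical morphism `(E → F) → E[1]`, the identity on `E`, as a morphism of degree `1`
from `(E → F)` to `E`. -/
noncomputable def coneOut {E F : TwistedComplex k C} (f : Hom k E F) (hf : f ∈ gr (k := k) E F 0)
    (hd : d (k := k) f = 0) : Hom k (cone k f hf hd) E
  | .inl a, b => id (k := k) E a b
  | .inr _, _ => 0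

end

end TwistedComplex

/-! ### Homotopy, isomorphisms, pretriangulated categories -/

/-- Whether one works on the nose in a DG-category or up to homotopy, i.e. in its homotopy
category `H⁰`. -/
inductive Level
  | strict
  | homotopy

section level
variable (k : Type w) [CommRing k] {C : Type u} [DGCategory.{v} k C]

/-- `f` and `g` differ by a boundary. For `f`, `g` closed and homogeneous of the same degree `p`
this means that they have the same class in `H^p`: if `f - g` is homogeneous of degree `p` and
equals `d h`, then it is `d` of the component of `h` of degree `p - 1`. -/
def Homotopic {X Y : C} (f g : Hom k X Y) : Prop := ∃ h : Hom k X Y, f - g = d (k := k) h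

/-- Equality on the nose, respectively equality up to homotopy. -/
def Same (L : Level) {X Y : C} (f g : Hom k X Y) : Prop :=
  match L with
  | .strict => f = g
  | .homotopy => Homotopic k f g

/-- `f` is a closed morphism of degree `p`. -/
def IsClosedOfDeg (p : ℤ) {X Y : C} (f : Hom k X Y) : Prop :=
  f ∈ gr (k := k) X Y p ∧ d (k := k) f = 0

/-- `f` is a closed isomorphism of degree `0` (at the level `strict`), respectively a homotopy
equivalence, i.e. an isomorphism in `H⁰` (at the level `homotopy`). -/
def IsEquivalence (L : Level) {X Y : C} (f : Hom k X Y) : Prop :=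
  IsClosedOfDeg k 0 f ∧ ∃ g : Hom k Y X, IsClosedOfDeg k 0 g ∧
    Same k L (comp (k := k) g f) (id (k := k) X) ∧ Same k L (comp (k := k) f g) (id (k := k) Y)

variable (C) in
/-- At the level `homotopy`: `C` is pretriangulated, i.e. the embedding of `C` into one-sided
twisted complexes over `C` is a quasi-equivalence. At the level `strict`: `C` is strongly
pretriangulated, i.e. this embedding is an equivalence of DG-categories. As the embedding is fully
faithful, both mean that every one-sided twisted complex is isomorphic, in `H⁰` respectively on the
nose, to an object of `C`, its convolution. -/
def IsPretriangulated (L : Level) : Prop :=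
  ∀ E : TwistedComplex k C, E.IsOneSided →
    ∃ (X : C) (θ : Hom k (TwistedComplex.single k X) E), IsEquivalence k L θ

open TwistedComplex in
/-- Closed morphisms `f : A → B`, `g : B → T` of degree `0` and `h : T → A` of degree `1`, i.e.
`T → A[1]`, give an exact triangle in `H⁰(C)`: it is isomorphic, in the homotopy category of
twisted complexes, to the triangle `E → F → (E → F) → E[1]` of a closed morphism `φ : E → F` of
degree `0`. -/
def IsExactTriangle {A B T : C} (f : Hom k A B) (g : Hom k B T) (h : Hom k T A) : Prop :=
  IsClosedOfDeg k 0 f ∧ IsClosedOfDeg k 0 g ∧ IsClosedOfDeg k 1 h ∧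
  ∃ (E F : TwistedComplex k C) (φ : Hom k E F) (hφ : IsClosedOfDeg k 0 φ)
    (a : Hom k (single k A) E) (b : Hom k (single k B) F)
    (c : Hom k (single k T) (cone k φ hφ.1 hφ.2)),
    IsEquivalence k .homotopy a ∧ IsEquivalence k .homotopy b ∧ IsEquivalence k .homotopy c ∧
    Homotopic k (comp (k := k) b (singleMap k f)) (comp (k := k) φ a) ∧
    Homotopic k (comp (k := k) c (singleMap k g)) (comp (k := k) (coneIn k φ hφ.1 hφ.2) b) ∧
    Homotopic k (comp (k := k) a (singleMap k h)) (comp (k := k) (coneOut k φ hφ.1 hφ.2) c)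

end level

/-! ### Twisted cubes -/

/-- The vertices `{-1, 0}^S` of the `S`-dimensional cube, with the componentwise order. -/
abbrev Vertex (S : Type) : Type := S → {x : SignType // x ≤ 0}

/-- The degree `|i| = ∑ s, i s` of a vertex. -/
def Vertex.deg {S : Type} [Fintype S] (i : Vertex S) : ℤ := ∑ s, ((i s).1 : ℤ)

open Classical in
/-- A twisted cube over `C` indexed by `{-1, 0}^S`: objects `obj i` and, for `i < j`, morphisms
`q i j` of degree `|i| - |j| + 1` with `(-1)^|j| d (q i j) + ∑ (i < m < j), q m j ∘ q i m = 0`.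
For pairs that are not of the form `i < j` there is no morphism; `q i j` is set to be `0`. -/
structure TwistedCube (k : Type w) [CommRing k] (C : Type u) [DGCategory.{v} k C]
    (S : Type) [Fintype S] where
  obj : Vertex S → C
  q : ∀ i j, Hom k (obj i) (obj j)
  q_eq_zero : ∀ i j, ¬ i < j → q i j = 0
  q_mem : ∀ i j, i < j → q i j ∈ gr (k := k) (obj i) (obj j) (i.deg - j.deg + 1)
  rel : ∀ i j, i < j → sgn k j.deg • d (k := k) (q i j) +
    ∑ m with i < m ∧ m < j, comp (k := k) (q m j) (q i m) = 0

/-- The vertices `{-1, 0, 1}^S` of the `S`-dimensional cube of side `2`. -/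
abbrev Vertex₂ (S : Type) : Type := S → SignType

namespace Vertex₂
variable {S : Type}

/-- The vertices `i` of `{-1, 0}^S` which have the same coordinates as `m` in all directions in
which `m` is not `1`. -/
def Face (m : Vertex₂ S) (i : Vertex S) : Prop := ∀ s, m s ≠ 1 → (i s).1 = m s

open Classical in
/-- The degree `|m'|` of the restriction `m'` of `m` to the directions in which it is not `1`. -/
noncomputable def deg [Fintype S] (m : Vertex₂ S) : ℤ := ∑ s with m s ≠ 1, (m s : ℤ)

open Classical in
/-- For a set `K` of directions, a vertex `m` of `{-1, 0, 1}^K` as the vertex of `{-1, 0, 1}^S`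
which is `m` on `K` and `1` elsewhere. -/
noncomputable def extend (K : Finset S) (m : Vertex₂ K) : Vertex₂ S :=
  fun s => if h : s ∈ K then m ⟨s, h⟩ else 1

open Classical in
/-- `v` with its coordinate in direction `a` replaced by `x`. -/
noncomputable def set (v : Vertex₂ S) (a : S) (x : SignType) : Vertex₂ S := Function.update v a x

end Vertex₂

/-- A vertex of `{-1, 0}^S` as a vertex of `{-1, 0, 1}^S`. -/
def Vertex.toVertex₂ {S : Type} (i : Vertex S) : Vertex₂ S := fun s => (i s).1

namespace TwistedCube

theorem sum_face {S : Type} (m : Vertex₂ S) {M : Type*} [AddCommMonoid M] (F : Vertex S → M)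
    [Fintype (Vertex S)] [Fintype {i : Vertex S // m.Face i}] [DecidablePred m.Face] :
    ∑ x : {i : Vertex S // m.Face i}, F x.1 = ∑ x, if m.Face x then F x else 0 := by
  rw [← Finset.sum_subtype (Finset.univ.filter fun x => m.Face x) (by simp) F, Finset.sum_filter]

theorem face_extend_iff {S : Type} (K : Finset S) (κ : Vertex K) (i : Vertex S) :
    (Vertex₂.extend K κ.toVertex₂).Face i ↔ (fun s : K => i s.1) = κ := by
  have h1 : ∀ s : K, ((κ s).1 : SignType) ≠ 1 := fun s => by
    generalize κ s = y; revert y; decide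
  constructor
  · intro h
    funext s
    have := h s.1 (by simpa [Vertex₂.extend, Vertex.toVertex₂] using h1 s)
    apply Subtype.ext
    simpa [Vertex₂.extend, Vertex.toVertex₂] using this
  · rintro rfl s hs
    by_cases h : s ∈ K
    · simp [Vertex₂.extend, Vertex.toVertex₂, h]
    · simp [Vertex₂.extend, h] at hs

theorem face_extend_of_face {S : Type} (K : Finset S) (m : Vertex₂ K) (κ : Vertex K) (i : Vertex S)
    (hκ : m.Face κ) (hi : (Vertex₂.extend K κ.toVertex₂).Face i) : (Vertex₂.extend K m).Face i := by
  rw [face_extend_iff] at hi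
  subst hi
  intro s hs
  by_cases h : s ∈ K
  · simp only [Vertex₂.extend, h, dif_pos] at hs ⊢
    exact hκ ⟨s, h⟩ hs
  · simp [Vertex₂.extend, h] at hs

theorem face_between {S : Type} {m : Vertex₂ S} {i x j : Vertex S} (hi : m.Face i) (hj : m.Face j)
    (h1 : i < x) (h2 : x < j) : m.Face x := fun s hs =>
  le_antisymm ((hj s hs) ▸ h2.le s) ((hi s hs) ▸ h1.le s)

section
variable {k : Type w} [CommRing k] {C : Type u} [DGCategory.{v} k C] {S : Type} [Fintype S]

open Classical in
theorem rel_all (X : TwistedCube k C S) (i j : Vertex S) :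
    sgn k j.deg • d (k := k) (X.q i j) + ∑ m, comp (k := k) (X.q m j) (X.q i m) = 0 := by
  have h : ∑ m, comp (k := k) (X.q m j) (X.q i m) =
      ∑ m with i < m ∧ m < j, comp (k := k) (X.q m j) (X.q i m) := by
    rw [Finset.sum_filter]
    refine Finset.sum_congr rfl fun m _ => ?_
    split_ifs with hm
    · rfl
    · by_cases h1 : i < m
      · rw [X.q_eq_zero m j fun h2 => hm ⟨h1, h2⟩]; simp
      · rw [X.q_eq_zero i m h1]; simp
  rw [h]
  by_cases hij : i < j
  · exact X.rel i j hij
  · rw [X.q_eq_zero i j hij, map_zero, smul_zero, zero_add]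
    refine Finset.sum_eq_zero fun m hm => ?_
    rw [Finset.mem_filter] at hm
    exact absurd (hm.2.1.trans hm.2.2) hij

theorem q_mem_all (X : TwistedCube k C S) (i j : Vertex S) :
    X.q i j ∈ gr (k := k) (X.obj i) (X.obj j) (i.deg - j.deg + 1) := by
  by_cases h : i < j
  · exact X.q_mem i j h
  · rw [X.q_eq_zero i j h]; exact Submodule.zero_mem _

end

section
variable {k : Type w} [CommRing k] {C : Type u} [DGCategory.{v} k C] {S : Type} [Fintype S]
  (X : TwistedCube k C S)

open Classical in
/-- The total complex of the sign-twisted subcube of `X` attached to a vertex `m` of the cube of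
side `2`: it consists of the objects `X i` for the vertices `i` which restrict to `m'` (the part of
`m` with coordinates different from `1`) and of the morphisms of `X` between them, multiplied by
`(-1)^|m'|`. The degree of `i` within the subcube is `|i| - |m'|`. -/
noncomputable def sub (m : Vertex₂ S) : TwistedComplex k C where
  ι := {i : Vertex S // m.Face i}
  deg i := i.1.deg - m.deg
  obj i := X.obj i.1
  α i j := sgn k m.deg • X.q i.1 j.1
  α_mem i j := by
    refine Submodule.smul_mem _ _ ?_
    have := X.q_mem_all i.1 j.1
    convert this using 1
    ring_nf
  maurerCartan i j := by
    have h := X.rel_all i.1 j.1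
    have hs : ∑ x : {i : Vertex S // m.Face i}, comp (k := k) (X.q x.1 j.1) (X.q i.1 x.1) =
        ∑ x, comp (k := k) (X.q x j.1) (X.q i.1 x) := by
      rw [← Finset.sum_subtype (Finset.univ.filter fun x => m.Face x) (by simp)
        (fun x => comp (k := k) (X.q x j.1) (X.q i.1 x)), Finset.sum_filter]
      refine Finset.sum_congr rfl fun x _ => ?_
      split_ifs with hx
      · rfl
      · by_cases h1 : i.1 < x
        · by_cases h2 : x < j.1
          · exact absurd (face_between i.2 j.2 h1 h2) hx
          · rw [X.q_eq_zero _ _ h2]; simp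
        · rw [X.q_eq_zero _ _ h1]; simp
    simp only [map_smul, LinearMap.smul_apply, smul_smul, sgn_mul_self, one_smul, hs, sgn_sub]
    rw [mul_assoc, sgn_mul_self, mul_one]
    exact h

theorem sub_isOneSided (m : Vertex₂ S) : (X.sub m).IsOneSided := by
  intro i j h
  have hlt : ¬ i.1 < j.1 := by
    intro hij
    have h1 : i.1.deg < j.1.deg := by
      obtain ⟨hle, s, hs⟩ := Pi.lt_def.mp hij
      refine Finset.sum_lt_sum (fun t _ => ?_) ⟨s, Finset.mem_univ s, ?_⟩
      · have key : ∀ x y : {x : SignType // x ≤ 0}, x ≤ y → (x.1 : ℤ) ≤ (y.1 : ℤ) := by decide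
        exact key _ _ (hle t)
      · have key : ∀ x y : {x : SignType // x ≤ 0}, x < y → (x.1 : ℤ) < (y.1 : ℤ) := by decide
        exact key _ _ hs
    have h2 : j.1.deg - m.deg ≤ i.1.deg - m.deg := h
    linarith
  change sgn k m.deg • X.q i.1 j.1 = 0
  rw [X.q_eq_zero _ _ hlt, smul_zero]

theorem deg_set_zero (v : Vertex₂ S) (a : S) : (v.set a 0).deg = (v.set a 1).deg := by
  classical
  simp only [Vertex₂.deg, Finset.sum_filter]
  refine Finset.sum_congr rfl fun s _ => ?_
  by_cases h : s = a
  · subst h; simp [Vertex₂.set]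
  · simp [Vertex₂.set, h]

theorem deg_set_neg (v : Vertex₂ S) (a : S) : (v.set a (-1)).deg = (v.set a 1).deg - 1 := by
  classical
  have h : ∀ s, (if (v.set a (-1)) s ≠ 1 then ((v.set a (-1)) s : ℤ) else 0) =
      (if (v.set a 1) s ≠ 1 then ((v.set a 1) s : ℤ) else 0) + if s = a then -1 else 0 := by
    intro s
    by_cases h : s = a
    · subst h; simp [Vertex₂.set]
    · simp [Vertex₂.set, h]
  simp only [Vertex₂.deg, Finset.sum_filter, h, Finset.sum_add_distrib]
  simp [sub_eq_add_neg]

open Classical in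
theorem row_rel (v : Vertex₂ S) (a : S) (i j : Vertex S) (hi : (v.set a (-1)).Face i)
    (hj : (v.set a 0).Face j) :
    sgn k j.deg • d (k := k) (X.q i j) +
      (∑ x, if (v.set a 0).Face x then comp (k := k) (X.q x j) (X.q i x) else 0) +
      (∑ x, if (v.set a (-1)).Face x then comp (k := k) (X.q x j) (X.q i x) else 0) = 0 := by
  rw [add_assoc, ← Finset.sum_add_distrib]
  refine Eq.trans ?_ (X.rel_all i j)
  congr 1
  refine Finset.sum_congr rfl fun x _ => ?_
  by_cases h1 : i < x
  swap
  · simp [X.q_eq_zero _ _ h1]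
  by_cases h2 : x < j
  swap
  · simp [X.q_eq_zero _ _ h2]
  have hx : ∀ s, s ≠ a → v s ≠ 1 → (x s).1 = v s := by
    intro s hs hv
    have hi' := hi s (by simpa [Vertex₂.set, hs] using hv)
    have hj' := hj s (by simpa [Vertex₂.set, hs] using hv)
    simp only [Vertex₂.set, ne_eq, hs, not_false_eq_true, Function.update_of_ne] at hi' hj'
    exact le_antisymm (hj' ▸ h2.le s) (hi' ▸ h1.le s)
  have key : ∀ e : SignType, e ≠ 1 → ((v.set a e).Face x ↔ (x a).1 = e) := by
    intro e he
    refine ⟨fun h => by simpa [Vertex₂.set, he] using h a (by simpa [Vertex₂.set] using he), ?_⟩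
    intro h s hs
    by_cases hsa : s = a
    · subst hsa; simpa [Vertex₂.set] using h
    · simp only [Vertex₂.set, ne_eq, hsa, not_false_eq_true, Function.update_of_ne] at hs ⊢
      exact hx s hsa hs
  rw [if_congr (key 0 (by decide)) rfl rfl, if_congr (key (-1) (by decide)) rfl rfl]
  have h3 : (x a).1 = 0 ∧ (x a).1 ≠ -1 ∨ (x a).1 = -1 ∧ (x a).1 ≠ 0 := by
    generalize x a = y; revert y; decide
  rcases h3 with ⟨h3, h4⟩ | ⟨h3, h4⟩
  · simp [h3]
  · simp [h3]

/-- For a row `l → m → n` of the cube of side `2` in direction `a` (i.e. `l`, `m`, `n` are `v` with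
the coordinate `a` replaced by `-1`, `0`, `1`), the morphism from the total complex of the
sign-twisted subcube at `l` to the one at `m` whose entries are the morphisms of the sign-twisted
subcube at `n`. -/
noncomputable def rowMap (v : Vertex₂ S) (a : S) :
    Hom k (X.sub (v.set a (-1))) (X.sub (v.set a 0)) :=
  fun i j => sgn k (v.set a 1).deg • X.q i.1 j.1

theorem rowMap_closed (v : Vertex₂ S) (a : S) : IsClosedOfDeg k 0 (X.rowMap v a) := by
  classical
  have hmem : X.rowMap v a ∈ gr (k := k) (X.sub (v.set a (-1))) (X.sub (v.set a 0)) 0 := by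
    intro i j
    have h : 0 + (i.1.deg - (v.set a (-1)).deg) - (j.1.deg - (v.set a 0).deg) =
        i.1.deg - j.1.deg + 1 := by
      rw [deg_set_zero, deg_set_neg]
      ring
    have h2 := Submodule.smul_mem _ (sgn k (v.set a 1).deg) (X.q_mem_all i.1 j.1)
    rw [← h] at h2
    exact h2
  refine ⟨hmem, ?_⟩
  funext i j
  rw [TwistedComplex.d_apply k hmem]
  change sgn k (j.1.deg - (v.set a 0).deg) • d (k := k) (sgn k (v.set a 1).deg • X.q i.1 j.1) +
    ∑ m : {i : Vertex S // (v.set a 0).Face i}, comp (k := k) (sgn k (v.set a 0).deg • X.q m.1 j.1)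
      (sgn k (v.set a 1).deg • X.q i.1 m.1) -
    sgn k 0 • ∑ m : {i : Vertex S // (v.set a (-1)).Face i},
      comp (k := k) (sgn k (v.set a 1).deg • X.q m.1 j.1)
        (sgn k (v.set a (-1)).deg • X.q i.1 m.1) = 0
  rw [deg_set_zero, deg_set_neg]
  simp only [map_smul, LinearMap.smul_apply, ← Finset.smul_sum]
  rw [sum_face (v.set a 0) (fun m => comp (k := k) (X.q m j.1) (X.q i.1 m)),
    sum_face (v.set a (-1)) (fun m => comp (k := k) (X.q m j.1) (X.q i.1 m)),
    smul_smul, smul_smul, smul_smul, smul_smul, sgn_sub, sgn_sub, sgn_one, sgn_zero, sgn_mul_self,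
    mul_assoc, sgn_mul_self, mul_one, one_smul, mul_neg, mul_one, one_mul, neg_mul, sgn_mul_self,
    neg_smul, one_smul, sub_neg_eq_add]
  exact X.row_rel v a i.1 j.1 i.2 j.2

/-- The total twisted complex of the one-dimensional twisted cube given by `rowMap`. -/
noncomputable abbrev rowCone (v : Vertex₂ S) (a : S) : TwistedComplex k C :=
  TwistedComplex.cone k (X.rowMap v a) (X.rowMap_closed v a).1 (X.rowMap_closed v a).2

open Classical in
/-- The identity between the objects of `X` at two vertices if these are equal, `0` otherwise. -/
noncomputable def idEntry (i j : Vertex S) : Hom k (X.obj i) (X.obj j) :=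
  if h : i = j then ofEq k (congrArg X.obj h) else 0

/-- The canonical morphism from `rowCone` to the total complex of the sign-twisted subcube at `n`,
the identity on each of the objects of this subcube. -/
noncomputable def coneTo (v : Vertex₂ S) (a : S) : Hom k (X.rowCone v a) (X.sub (v.set a 1))
  | .inl i, j => X.idEntry i.1 j.1
  | .inr i, j => X.idEntry i.1 j.1

/-- The canonical morphism in the opposite direction of `coneTo`. -/
noncomputable def coneFrom (v : Vertex₂ S) (a : S) : Hom k (X.sub (v.set a 1)) (X.rowCone v a)
  | i, .inl j => X.idEntry i.1 j.1
  | i, .inr j => X.idEntry i.1 j.1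

theorem deg_extend (K : Finset S) (κ : Vertex K) :
    (Vertex₂.extend K κ.toVertex₂).deg = κ.deg := by
  classical
  have h1 : ∀ s : K, ((κ s).1 : SignType) ≠ 1 := fun s => by
    generalize κ s = y; revert y; decide
  have h2 : (Vertex₂.extend K κ.toVertex₂).deg =
      ∑ s ∈ K, if h : s ∈ K then (((κ ⟨s, h⟩).1 : SignType) : ℤ) else 0 := by
    rw [Vertex₂.deg]
    refine (Finset.sum_congr ?_ fun s hs => ?_)
    · ext s
      by_cases h : s ∈ K
      · simpa [Vertex₂.extend, h, Vertex.toVertex₂] using h1 ⟨s, h⟩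
      · simp [Vertex₂.extend, h]
    · simp [Vertex₂.extend, hs, Vertex.toVertex₂]
  rw [h2, Vertex.deg, ← Finset.sum_coe_sort K]
  refine Finset.sum_congr rfl fun s _ => ?_
  simp

/-- The matrix of those morphisms of `X` which go from the subcube at `m` to the subcube at `n`. -/
noncomputable def qMap (m n : Vertex₂ S) : Hom k (X.sub m) (X.sub n) := fun i j => X.q i.1 j.1

theorem qMap_mem (K : Finset S) (κ μ : Vertex K) :
    X.qMap (Vertex₂.extend K κ.toVertex₂) (Vertex₂.extend K μ.toVertex₂) ∈
      gr (k := k) _ _ (κ.deg - μ.deg + 1) := by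
  intro i j
  have h : κ.deg - μ.deg + 1 + (i.1.deg - (Vertex₂.extend K κ.toVertex₂).deg) -
      (j.1.deg - (Vertex₂.extend K μ.toVertex₂).deg) = i.1.deg - j.1.deg + 1 := by
    rw [deg_extend, deg_extend]
    ring
  have h2 := X.q_mem_all i.1 j.1
  rw [← h] at h2
  exact h2

open Classical in
theorem qMap_comp_apply (l m n : Vertex₂ S) (i : (X.sub l).ι) (j : (X.sub n).ι) :
    (comp (k := k) (X.qMap m n) (X.qMap l m) : Fam.Mat k (X.sub l).toFam (X.sub n).toFam) i j =
      ∑ x, if m.Face x then comp (k := k) (X.q x j.1) (X.q i.1 x) else 0 :=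
  sum_face m (fun x => comp (k := k) (X.q x j.1) (X.q i.1 x))

open Classical in
theorem slice_rel (K : Finset S) (κ μ : Vertex K) (h : κ < μ) (i j : Vertex S)
    (hi : (fun s : K => i s.1) = κ) (hj : (fun s : K => j s.1) = μ) :
    sgn k j.deg • d (k := k) (X.q i j) +
      (∑ x, if (fun s : K => x s.1) = μ then comp (k := k) (X.q x j) (X.q i x) else 0) +
      (∑ x, if (fun s : K => x s.1) = κ then comp (k := k) (X.q x j) (X.q i x) else 0) +
      (∑ m with κ < m ∧ m < μ, ∑ x : Vertex S,
        if (fun s : K => x s.1) = m then comp (k := k) (X.q x j) (X.q i x) else 0) = 0 := by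
  rw [Finset.sum_comm, add_assoc, add_assoc, ← Finset.sum_add_distrib, ← Finset.sum_add_distrib]
  refine Eq.trans ?_ (X.rel_all i j)
  congr 1
  refine Finset.sum_congr rfl fun x _ => ?_
  rw [Finset.sum_ite_eq]
  by_cases h1 : i < x
  swap
  · simp [X.q_eq_zero _ _ h1]
  by_cases h2 : x < j
  swap
  · simp [X.q_eq_zero _ _ h2]
  have hκ : κ ≤ fun s : K => x s.1 := by
    rw [← hi]
    exact fun s => h1.le s.1
  have hμ : (fun s : K => x s.1) ≤ μ := by
    rw [← hj]
    exact fun s => h2.le s.1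
  by_cases h3 : (fun s : K => x s.1) = κ
  · have h4 : ¬ κ = μ := h.ne
    simp [h3, h4]
  · by_cases h4 : (fun s : K => x s.1) = μ
    · have h5 : ¬ μ = κ := h.ne'
      simp [h4, h5]
    · simp [h3, h4, lt_of_le_of_ne hκ (Ne.symm h3), lt_of_le_of_ne hμ h4]

open Classical in
theorem qMap_rel (K : Finset S) (κ μ : Vertex K) (h : κ < μ) :
    sgn k μ.deg • d (k := k) (X.qMap (Vertex₂.extend K κ.toVertex₂) (Vertex₂.extend K μ.toVertex₂)) +
      ∑ m with κ < m ∧ m < μ,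
        comp (k := k) (X.qMap (Vertex₂.extend K m.toVertex₂) (Vertex₂.extend K μ.toVertex₂))
          (X.qMap (Vertex₂.extend K κ.toVertex₂) (Vertex₂.extend K m.toVertex₂)) = 0 := by
  funext i j
  have hs2 : ∀ (A : Hom k (X.sub (Vertex₂.extend K κ.toVertex₂))
      (X.sub (Vertex₂.extend K μ.toVertex₂))) (c : k) (s : Finset (Vertex K))
      (F : Vertex K → Fam.Mat k (X.sub (Vertex₂.extend K κ.toVertex₂)).toFam
          (X.sub (Vertex₂.extend K μ.toVertex₂)).toFam),
      (c • A + ∑ m ∈ s, F m : Fam.Mat k (X.sub (Vertex₂.extend K κ.toVertex₂)).toFam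
          (X.sub (Vertex₂.extend K μ.toVertex₂)).toFam) i j = c • A i j + ∑ m ∈ s, F m i j := by
    intro A c s F
    rw [Pi.add_apply, Pi.add_apply, Finset.sum_apply, Finset.sum_apply]
    rfl
  refine (hs2 _ _ _ _).trans ?_
  rw [Finset.sum_congr rfl fun m _ => X.qMap_comp_apply _ _ _ i j,
    TwistedComplex.d_apply k (X.qMap_mem K κ μ)]
  change sgn k μ.deg • (sgn k (j.1.deg - (Vertex₂.extend K μ.toVertex₂).deg) •
      d (k := k) (X.q i.1 j.1) +
    ∑ m : {i : Vertex S // (Vertex₂.extend K μ.toVertex₂).Face i},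
      comp (k := k) (sgn k (Vertex₂.extend K μ.toVertex₂).deg • X.q m.1 j.1) (X.q i.1 m.1) -
    sgn k (κ.deg - μ.deg + 1) • ∑ m : {i : Vertex S // (Vertex₂.extend K κ.toVertex₂).Face i},
      comp (k := k) (X.q m.1 j.1) (sgn k (Vertex₂.extend K κ.toVertex₂).deg • X.q i.1 m.1)) +
    _ = 0
  rw [deg_extend, deg_extend]
  simp only [map_smul, LinearMap.smul_apply]
  rw [← Finset.smul_sum, ← Finset.smul_sum,
    sum_face (Vertex₂.extend K μ.toVertex₂) (fun m => comp (k := k) (X.q m j.1) (X.q i.1 m)),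
    sum_face (Vertex₂.extend K κ.toVertex₂) (fun m => comp (k := k) (X.q m j.1) (X.q i.1 m))]
  simp only [face_extend_iff, sgn_add, sgn_sub, sgn_one, smul_add, smul_sub, smul_smul]
  have e1 : sgn k μ.deg * (sgn k j.1.deg * sgn k μ.deg) = sgn k j.1.deg := by
    linear_combination sgn k j.1.deg * sgn_mul_self k μ.deg
  have e2 : sgn k μ.deg * (sgn k κ.deg * sgn k μ.deg * -1 * sgn k κ.deg) = -1 := by
    linear_combination (- sgn k μ.deg * sgn k μ.deg) * sgn_mul_self k κ.deg
      - sgn_mul_self k μ.deg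
  rw [e1, e2, sgn_mul_self, one_smul, neg_smul, one_smul, sub_neg_eq_add]
  exact X.slice_rel K κ μ h i.1 j.1 ((face_extend_iff K κ i.1).mp i.2)
    ((face_extend_iff K μ j.1).mp j.2)

open Classical in
/-- For a splitting of the set of directions of `X` into `K` and its complement, the twisted cube
indexed by `{-1, 0}^K` over twisted complexes over `C`: its objects are the total complexes of the
sign-twisted subcubes of `X` at the vertices of `{-1, 0}^K`, and its morphisms have the morphisms
of `X` as entries. The objects are one-sided twisted complexes by `sub_isOneSided`. -/
noncomputable def slices (K : Finset S) : TwistedCube k (TwistedComplex k C) K where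
  obj κ := X.sub (Vertex₂.extend K κ.toVertex₂)
  q κ μ := if κ < μ then X.qMap (Vertex₂.extend K κ.toVertex₂) (Vertex₂.extend K μ.toVertex₂) else 0
  q_eq_zero κ μ h := by simp [h]
  q_mem κ μ h := by
    rw [if_pos h]
    exact X.qMap_mem K κ μ
  rel κ μ h := by
    rw [if_pos h, ← X.qMap_rel K κ μ h]
    congr 1
    refine Finset.sum_congr (by ext m; simp only [Finset.mem_filter, Finset.mem_univ]) fun m hm => ?_
    rw [Finset.mem_filter] at hm
    rw [if_pos hm.2.1, if_pos hm.2.2]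

end

end TwistedCube

/-! ### Cubes of side `2` -/

/-- A diagram in `C` indexed by `{-1, 0, 1}^S`. -/
structure SideTwoDiagram (k : Type w) [CommRing k] (C : Type u) [DGCategory.{v} k C]
    (S : Type) where
  obj : Vertex₂ S → C
  r : ∀ m n, Hom k (obj m) (obj n)

namespace SideTwoDiagram

section
variable {k : Type w} [CommRing k] {C : Type u} [DGCategory.{v} k C] {S : Type} [Fintype S]

open TwistedComplex in
/-- The diagram `Z`, together with the equivalences `θ m` from its objects to the total complexes
of the sign-twisted subcubes of `X`, is a completion of the twisted cube `X` to a cube of side `2`.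
A morphism `l → m[1]` is written as a morphism `l → m` of degree `1`. -/
structure IsCompletion (L : Level) (X : TwistedCube k C S) (Z : SideTwoDiagram k C S)
    (θ : ∀ m, Hom k (single k (Z.obj m)) (X.sub m)) : Prop where
  /-- `Z m` is, via `θ m`, the convolution of the sign-twisted subcube of `X` at `m` -/
  equivalence : ∀ m, IsEquivalence k L (θ m)
  /-- the morphisms in a row `l → m → n → l[1]` are closed of degrees `0`, `0`, `1` -/
  closed₁ : ∀ (v : Vertex₂ S) (a : S), IsClosedOfDeg k 0 (Z.r (v.set a (-1)) (v.set a 0))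
  closed₂ : ∀ (v : Vertex₂ S) (a : S), IsClosedOfDeg k 0 (Z.r (v.set a 0) (v.set a 1))
  closed₃ : ∀ (v : Vertex₂ S) (a : S), IsClosedOfDeg k 1 (Z.r (v.set a 1) (v.set a (-1)))
  /-- the row is, via `θ`, the image of
  `Y l → Y m → (Y l → Y m) → Y l [1]`, the convolution `Z n` of `Y n` being identified with that of
  `(Y l → Y m)` by the canonical isomorphism -/
  row₁ : ∀ (v : Vertex₂ S) (a : S), Same k L
    (comp (k := k) (θ (v.set a 0)) (singleMap k (Z.r (v.set a (-1)) (v.set a 0))))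
    (comp (k := k) (X.rowMap v a) (θ (v.set a (-1))))
  row₂ : ∀ (v : Vertex₂ S) (a : S), Same k L
    (comp (k := k) (θ (v.set a 1)) (singleMap k (Z.r (v.set a 0) (v.set a 1))))
    (comp (k := k) (X.coneTo v a) (comp (k := k)
      (coneIn k (X.rowMap v a) (X.rowMap_closed v a).1 (X.rowMap_closed v a).2) (θ (v.set a 0))))
  row₃ : ∀ (v : Vertex₂ S) (a : S), Same k L
    (comp (k := k) (θ (v.set a (-1))) (singleMap k (Z.r (v.set a 1) (v.set a (-1)))))
    (comp (k := k)
      (coneOut k (X.rowMap v a) (X.rowMap_closed v a).1 (X.rowMap_closed v a).2)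
      (comp (k := k) (X.coneFrom v a) (θ (v.set a 1))))
  /-- all morphisms of `Z` which do not occur in a row are `0` -/
  zero : ∀ m n, (∀ (v : Vertex₂ S) (a : S), ¬ (m = v.set a (-1) ∧ n = v.set a 0) ∧
    ¬ (m = v.set a 0 ∧ n = v.set a 1) ∧ ¬ (m = v.set a 1 ∧ n = v.set a (-1))) → Z.r m n = 0

/-- For a set `K` of directions, the subcube of `Z` at the vertices with all coordinates outside of
`K` equal to `1`, as a diagram indexed by `{-1, 0, 1}^K` of (one-term) twisted complexes. -/
noncomputable def restrict (Z : SideTwoDiagram k C S) (K : Finset S) :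
    SideTwoDiagram k (TwistedComplex k C) K where
  obj m := TwistedComplex.single k (Z.obj (Vertex₂.extend K m))
  r m n := TwistedComplex.singleMap k (Z.r (Vertex₂.extend K m) (Vertex₂.extend K n))

/-- The morphisms with the same components as `θ`, from the objects of `Z.restrict K` to the total
complexes of the sign-twisted subcubes of `X.slices K`: the objects of `X` which occur in the
sign-twisted subcube of `X.slices K` at `m` are those which occur in the sign-twisted subcube of
`X` at `extend K m`. -/
noncomputable def restrictθ {X : TwistedCube k C S} {Z : SideTwoDiagram k C S}
    (θ : ∀ m, Hom k (TwistedComplex.single k (Z.obj m)) (X.sub m)) (K : Finset S) (m : Vertex₂ K) :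
    Hom k (TwistedComplex.single k ((Z.restrict K).obj m)) ((X.slices K).sub m) :=
  fun _ κ _ i => θ (Vertex₂.extend K m) () ⟨i.1, TwistedCube.face_extend_of_face K m κ.1 i.1 κ.2 i.2⟩

end

/-! Paths in a diagram -/

/-- The successor of `x` in the cyclic order `-1 → 0 → 1 → -1`. -/
def next (x : SignType) : SignType := if x = -1 then 0 else if x = 0 then 1 else -1

section
variable {k : Type w} [CommRing k] {C : Type u} [DGCategory.{v} k C] {S : Type}

/-- The vertex following `m` in the row through `m` in direction `a`. -/
noncomputable def step (m : Vertex₂ S) (a : S) : Vertex₂ S := m.set a (next (m a))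

/-- The end of the path which starts at `m` and moves along the rows in the given directions. -/
noncomputable def pathEnd : Vertex₂ S → List S → Vertex₂ S
  | m, [] => m
  | m, a :: w => pathEnd (step m a) w

/-- The composition in `C` of the morphisms of `Z` along a path. -/
noncomputable def pathHom (Z : SideTwoDiagram k C S) :
    ∀ (m : Vertex₂ S) (w : List S), Hom k (Z.obj m) (Z.obj (pathEnd m w))
  | m, [] => id (k := k) (Z.obj m)
  | m, a :: w => comp (k := k) (pathHom Z (step m a) w) (Z.r m (step m a))

/-- The degree of the composition along a path: the number of times the path wraps around. -/
noncomputable def pathDeg : Vertex₂ S → List S → ℤ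
  | _, [] => 0
  | m, a :: w => pathDeg (step m a) w + if m a = 1 then 1 else 0

/-- The image of the diagram in `H⁰(C)` commutes up to isomorphisms `± id`: any two paths with the
same ends and the same degree have, up to sign, homotopic compositions. (Morphisms of degree `1`
are the morphisms to a shifted object.) -/
def CommutesUpToSign (Z : SideTwoDiagram k C S) : Prop :=
  ∀ (m : Vertex₂ S) (w w' : List S) (h : pathEnd m w = pathEnd m w'),
    pathDeg m w = pathDeg m w' → ∃ ε : ℤˣ,
      Homotopic k (comp (k := k) (ofEq k (congrArg Z.obj h)) (pathHom Z m w))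
        ((ε : ℤ) • pathHom Z m w')

end

end SideTwoDiagram

end DGCategory

/-! Every assertion about Z is an assertion about the explicit complexes Y^m: each `θ m` is
invertible at the chosen level, and closed morphisms, homotopies and equivalences between one-term
complexes come from `C`. For a row l → m → n in direction `a`, the vertices of the subcube at n are
the disjoint union of those at l and m, and no morphism of `X` leads from the m-part to the l-part.
The signs of the subcubes are such that Y^n is, up to relabelling, the cone of Y^l → Y^m
(`coneTo_closed`). The three arrows of a row thereby become matrices `edge`: signed morphisms of `X`
out of coordinate -1, identities of the common objects out of coordinates 0 and 1.

Existence and uniqueness are transport along the equivalences: if ξ denotes an inverse of θ, put r =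
ξ ∘ edge ∘ θ and φ = ξ' ∘ θ. Exactness of the rows is the identification of Y^n with a cone.

For commutativity, the squares of edges commute up to sign (`edge_comm`), and even without a
homotopy unless both directions start at -1; there the relation of the twisted cube makes the
diagonal morphisms a homotopy. Two successive edges in one direction compose to zero up to homotopy
(`edge_comp_edge`). So the steps of a path may be permuted, a path that uses a direction twice is
null-homotopic, and for the other paths the ends and the degree determine the directions up to
order.

For recursivity, the total complex of a complex of total complexes consists of the same matrices,
grouped into blocks. Grouping commutes with composition and differential (`block_comp`, `d_block`),
and the signs fit because the coordinates 1 outside of K contribute nothing to the degree of a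
vertex. -/

namespace DGCategory

/-! ### Calculus of closed morphisms, homotopies and equivalences -/

section congruence
variable {k : Type w} [CommRing k] {C : Type u} [DGCategory.{v} k C]

theorem comp_d_of_closed {X Y Z : C} {p : ℤ} {g : Hom k Y Z} (hg : IsClosedOfDeg k p g)
    (h : Hom k X Y) :
    comp (k := k) g (d (k := k) h) = d (k := k) (sgn k p • comp (k := k) g h) := by
  rw [map_smul, d_comp h hg.1, hg.2]
  change _ = sgn k p • (_ + sgn k p • _)
  rw [map_zero, LinearMap.zero_apply, zero_add, smul_smul, sgn_mul_self, one_smul]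

theorem d_comp_of_closed {X Y Z : C} (h : Hom k Y Z) {f : Hom k X Y} (hf : d (k := k) f = 0) :
    comp (k := k) (d (k := k) h) f = d (k := k) (comp (k := k) h f) := by
  rw [d_comp_par, hf, map_zero, add_zero]

theorem isClosedOfDeg_id (X : C) : IsClosedOfDeg k 0 (id (k := k) X) := by
  refine ⟨id_mem X, ?_⟩
  have h := d_comp (k := k) (id (k := k) X) (id_mem (k := k) X)
  rw [id_comp, id_comp, comp_id] at h
  simpa using h

theorem IsClosedOfDeg.comp {X Y Z : C} {p q : ℤ} {g : Hom k Y Z} {f : Hom k X Y}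
    (hg : IsClosedOfDeg k p g) (hf : IsClosedOfDeg k q f) :
    IsClosedOfDeg k (p + q) (comp (k := k) g f) := by
  refine ⟨comp_mem hg.1 hf.1, ?_⟩
  rw [d_comp_par, hf.2, hg.2]
  simp

theorem IsClosedOfDeg.comp₀ {X Y Z : C} {g : Hom k Y Z} {f : Hom k X Y}
    (hg : IsClosedOfDeg k 0 g) (hf : IsClosedOfDeg k 0 f) :
    IsClosedOfDeg k 0 (DGCategory.comp (k := k) g f) := by
  simpa using hg.comp hf

theorem IsClosedOfDeg.zsmul {X Y : C} {p : ℤ} {f : Hom k X Y} (hf : IsClosedOfDeg k p f) (n : ℤ) :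
    IsClosedOfDeg k p (n • f) :=
  ⟨zsmul_mem hf.1 n, by rw [map_zsmul, hf.2, smul_zero]⟩

theorem Homotopic.refl {X Y : C} (f : Hom k X Y) : Homotopic k f f := ⟨0, by simp⟩

theorem Homotopic.symm {X Y : C} {f g : Hom k X Y} (h : Homotopic k f g) : Homotopic k g f := by
  obtain ⟨a, ha⟩ := h
  exact ⟨-a, by rw [map_neg, ← ha]; abel⟩

theorem Homotopic.trans {X Y : C} {f g h : Hom k X Y} (h₁ : Homotopic k f g)
    (h₂ : Homotopic k g h) : Homotopic k f h := by
  obtain ⟨a, ha⟩ := h₁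
  obtain ⟨b, hb⟩ := h₂
  exact ⟨a + b, by rw [map_add, ← ha, ← hb]; abel⟩

theorem Homotopic.zsmul {X Y : C} {f g : Hom k X Y} (h : Homotopic k f g) (n : ℤ) :
    Homotopic k (n • f) (n • g) := by
  obtain ⟨a, ha⟩ := h
  exact ⟨n • a, by rw [map_zsmul, ← ha, smul_sub]⟩

theorem Homotopic.comp_left {X Y Z : C} {p : ℤ} {g : Hom k Y Z} (hg : IsClosedOfDeg k p g)
    {f f' : Hom k X Y} (h : Homotopic k f f') :
    Homotopic k (comp (k := k) g f) (comp (k := k) g f') := by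
  obtain ⟨a, ha⟩ := h
  exact ⟨_, by rw [← map_sub, ha, comp_d_of_closed hg]⟩

theorem Homotopic.comp_right {X Y Z : C} {g g' : Hom k Y Z} (h : Homotopic k g g')
    {f : Hom k X Y} (hf : d (k := k) f = 0) :
    Homotopic k (comp (k := k) g f) (comp (k := k) g' f) := by
  obtain ⟨a, ha⟩ := h
  exact ⟨_, by rw [← LinearMap.sub_apply, ← map_sub, ha, d_comp_of_closed a hf]⟩

theorem Same.of_eq (L : Level) {X Y : C} {f g : Hom k X Y} (h : f = g) : Same k L f g := by
  subst h
  cases L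
  · rfl
  · exact Homotopic.refl f

variable {L : Level}

theorem Same.refl {X Y : C} (f : Hom k X Y) : Same k L f f := Same.of_eq L rfl

theorem Same.symm {X Y : C} {f g : Hom k X Y} (h : Same k L f g) : Same k L g f := by
  cases L
  · exact Eq.symm h
  · exact Homotopic.symm h

theorem Same.trans {X Y : C} {f g h : Hom k X Y} (h₁ : Same k L f g) (h₂ : Same k L g h) :
    Same k L f h := by
  cases L
  · exact Eq.trans h₁ h₂
  · exact Homotopic.trans h₁ h₂

theorem Same.homotopic {X Y : C} {f g : Hom k X Y} (h : Same k L f g) : Homotopic k f g := by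
  cases L
  · cases h
    exact Homotopic.refl f
  · exact h

theorem Same.comp_left {X Y Z : C} {p : ℤ} {g : Hom k Y Z} (hg : IsClosedOfDeg k p g)
    {f f' : Hom k X Y} (h : Same k L f f') :
    Same k L (comp (k := k) g f) (comp (k := k) g f') := by
  cases L
  · exact congrArg _ h
  · exact Homotopic.comp_left hg h

theorem Same.comp_right {X Y Z : C} {g g' : Hom k Y Z} (h : Same k L g g')
    {f : Hom k X Y} {p : ℤ} (hf : IsClosedOfDeg k p f) :
    Same k L (comp (k := k) g f) (comp (k := k) g' f) := by
  cases L
  · exact congrArg (fun g => comp (k := k) g f) h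
  · exact Homotopic.comp_right h hf.2

/-- Closed morphisms can be cancelled from the left if they have a left inverse. -/
theorem Same.cancel_left {X Y Z : C} {θ : Hom k Y Z} {ξ : Hom k Z Y}
    (hξ : IsClosedOfDeg k 0 ξ) (h : Same k L (comp (k := k) ξ θ) (id (k := k) Y))
    {p q : ℤ} {f g : Hom k X Y} (hf : IsClosedOfDeg k p f) (hg : IsClosedOfDeg k q g)
    (hfg : Same k L (comp (k := k) θ f) (comp (k := k) θ g)) : Same k L f g := by
  have h1 := hfg.comp_left hξ
  rw [← assoc, ← assoc] at h1
  have h2 := (h.comp_right hf).symm.trans (h1.trans (h.comp_right hg))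
  rwa [id_comp, id_comp] at h2

theorem IsEquivalence.cancel_left {X Y Z : C} {θ : Hom k Y Z} (hθ : IsEquivalence k L θ)
    {p q : ℤ} {f g : Hom k X Y} (hf : IsClosedOfDeg k p f) (hg : IsClosedOfDeg k q g)
    (hfg : Same k L (comp (k := k) θ f) (comp (k := k) θ g)) : Same k L f g := by
  obtain ⟨_, ξ, hξ, h1, _⟩ := hθ
  exact Same.cancel_left hξ h1 hf hg hfg

theorem IsEquivalence.homotopy {X Y : C} {f : Hom k X Y} (h : IsEquivalence k L f) :
    IsEquivalence k .homotopy f := by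
  obtain ⟨h1, g, h2, h3, h4⟩ := h
  exact ⟨h1, g, h2, h3.homotopic, h4.homotopic⟩

theorem IsEquivalence.comp {X Y Z : C} {g : Hom k Y Z} {f : Hom k X Y}
    (hg : IsEquivalence k L g) (hf : IsEquivalence k L f) :
    IsEquivalence k L (comp (k := k) g f) := by
  obtain ⟨hg, g', hg', g1, g2⟩ := hg
  obtain ⟨hf, f', hf', f1, f2⟩ := hf
  refine ⟨hg.comp₀ hf, DGCategory.comp (k := k) f' g', hf'.comp₀ hg', ?_, ?_⟩
  · have h := (g1.comp_right hf).comp_left hf'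
    rw [id_comp, assoc] at h
    rw [assoc]
    exact h.trans f1
  · have h := (f2.comp_right hg').comp_left hg
    rw [id_comp, assoc] at h
    rw [assoc]
    exact h.trans g2

end congruence

/-! ### One-term twisted complexes -/

namespace TwistedComplex
variable {k : Type w} [CommRing k] {C : Type u} [DGCategory.{v} k C]

/-- The embedding of `C` is full because matrices between one-term complexes have a single entry.
Morphisms and homotopies constructed among twisted complexes therefore descend to `C`. -/
theorem exists_singleMap_eq {X Y : C} (f : Hom k (single k X) (single k Y)) :
    ∃ g : Hom k X Y, singleMap k g = f := ⟨f () (), rfl⟩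

theorem singleMap_injective {X Y : C} {f g : Hom k X Y} (h : singleMap k f = singleMap k g) :
    f = g := congrFun (congrFun h ()) ()

theorem singleMap_id (X : C) : singleMap k (id (k := k) X) = id (k := k) (single k X) := by
  funext i j
  exact (Fam.matId_self k (single k X).toFam ()).symm

theorem singleMap_comp {X Y Z : C} (g : Hom k Y Z) (f : Hom k X Y) :
    singleMap k (comp (k := k) g f) = comp (k := k) (singleMap k g) (singleMap k f) := by
  funext i j
  exact (Fintype.sum_unique (fun m : Unit => comp (k := k) g f)).symm

theorem singleMap_mem {X Y : C} {p : ℤ} {f : Hom k X Y} :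
    singleMap k f ∈ gr (k := k) (single k X) (single k Y) p ↔ f ∈ gr (k := k) X Y p := by
  have h : p + (0 : ℤ) - 0 = p := by ring
  constructor
  · intro hf
    have := hf () ()
    change f ∈ gr (k := k) X Y (p + 0 - 0) at this
    rwa [h] at this
  · intro hf i j
    change f ∈ gr (k := k) X Y (p + 0 - 0)
    rwa [h]

theorem d_singleMap {X Y : C} (f : Hom k X Y) :
    d (k := k) (singleMap k f) = singleMap k (d (k := k) f) := by
  induction f using hom_induction (k := k) with
  | hom p f hf =>
    funext i j
    rw [d_apply k (singleMap_mem.2 hf)]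
    change sgn k 0 • d (k := k) f + ∑ m : Unit, comp (k := k) (0 : Hom k Y Y) f -
      sgn k p • ∑ m : Unit, comp (k := k) f (0 : Hom k X X) = d (k := k) f
    simp [sgn_zero]
  | add f g hf hg =>
    have h (f g : Hom k X Y) : singleMap k (f + g) = singleMap k f + singleMap k g := rfl
    rw [h, map_add, hf, hg, map_add, h]

theorem isClosedOfDeg_singleMap {X Y : C} {p : ℤ} {f : Hom k X Y} :
    IsClosedOfDeg k p (singleMap k f) ↔ IsClosedOfDeg k p f := by
  refine and_congr singleMap_mem ?_
  rw [d_singleMap]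
  exact ⟨fun h => singleMap_injective h, fun h => by rw [h]; rfl⟩

theorem same_singleMap {L : Level} {X Y : C} {f g : Hom k X Y} :
    Same k L (singleMap k f) (singleMap k g) ↔ Same k L f g := by
  cases L
  · exact ⟨fun h => singleMap_injective h, fun h => congrArg _ h⟩
  · constructor
    · rintro ⟨h, hh⟩
      obtain ⟨h, rfl⟩ := exists_singleMap_eq h
      refine ⟨h, singleMap_injective (k := k) ?_⟩
      rw [← d_singleMap, ← hh]
      rfl
    · rintro ⟨h, hh⟩
      refine ⟨singleMap k h, ?_⟩
      rw [d_singleMap, ← hh]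
      rfl

theorem isEquivalence_singleMap {L : Level} {X Y : C} {f : Hom k X Y} :
    IsEquivalence k L (singleMap k f) ↔ IsEquivalence k L f := by
  refine and_congr isClosedOfDeg_singleMap ⟨?_, ?_⟩
  · rintro ⟨g, h1, h2, h3⟩
    obtain ⟨g, rfl⟩ := exists_singleMap_eq g
    refine ⟨g, isClosedOfDeg_singleMap.1 h1, same_singleMap.1 ?_, same_singleMap.1 ?_⟩
    · rwa [singleMap_comp, singleMap_id]
    · rwa [singleMap_comp, singleMap_id]
  · rintro ⟨g, h1, h2, h3⟩
    refine ⟨singleMap k g, isClosedOfDeg_singleMap.2 h1, ?_, ?_⟩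
    · rw [← singleMap_comp, ← singleMap_id]
      exact same_singleMap.2 h2
    · rw [← singleMap_comp, ← singleMap_id]
      exact same_singleMap.2 h3

end TwistedComplex

end DGCategory

namespace DGCategory

/-- Differentiating g f = id gives (dg) f = 0, since f and the identity are closed; composing with g
on the right kills dg. -/
theorem eq_zero_of_closed_isomorphism {k : Type w} [CommRing k] {C : Type u}
    [DGCategory.{v} k C] {X Y : C} {f : Hom k X Y} {g : Hom k Y X}
    (hf : IsClosedOfDeg k 0 f) (hg : g ∈ gr (k := k) Y X 0)
    (hgf : comp (k := k) g f = id (k := k) X) (hfg : comp (k := k) f g = id (k := k) Y) :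
    d (k := k) g = 0 := by
  have h := d_comp (k := k) f hg
  rw [hgf, (isClosedOfDeg_id (k := k) X).2, hf.2, map_zero, smul_zero, add_zero] at h
  rw [← comp_id (k := k) (d (k := k) g), ← hfg, ← assoc, ← h]
  simp

/-! ### Rows as steps in the cyclic order of the coordinates -/

namespace SideTwoDiagram
variable {S : Type}

theorem step_set_neg (v : Vertex₂ S) (a : S) : step (v.set a (-1)) a = v.set a 0 := by
  simp [step, Vertex₂.set, next]

theorem step_set_zero (v : Vertex₂ S) (a : S) : step (v.set a 0) a = v.set a 1 := by
  simp [step, Vertex₂.set, next]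

theorem step_set_one (v : Vertex₂ S) (a : S) : step (v.set a 1) a = v.set a (-1) := by
  simp [step, Vertex₂.set, next]

/-- The three arrows of a row, wrap-around included, are the three cases of one cyclic step. This
allows them to be treated uniformly later on. -/
theorem exists_row_of_eq_step {m n : Vertex₂ S} {a : S} (h : n = step m a) :
    (∃ v : Vertex₂ S, m = v.set a (-1) ∧ n = v.set a 0) ∨
    (∃ v : Vertex₂ S, m = v.set a 0 ∧ n = v.set a 1) ∨
    (∃ v : Vertex₂ S, m = v.set a 1 ∧ n = v.set a (-1)) := by
  classical
  have hm : m = m.set a (m a) := (Function.update_eq_self a m).symm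
  rcases (by generalize m a = x; revert x; decide : m a = -1 ∨ m a = 0 ∨ m a = 1) with h1 | h1 | h1
  · rw [h1] at hm
    exact .inl ⟨m, hm, by rw [h, hm, step_set_neg, ← hm]⟩
  · rw [h1] at hm
    exact .inr (.inl ⟨m, hm, by rw [h, hm, step_set_zero, ← hm]⟩)
  · rw [h1] at hm
    exact .inr (.inr ⟨m, hm, by rw [h, hm, step_set_one, ← hm]⟩)

theorem next_ne (x : SignType) : next x ≠ x := by revert x; decide

theorem step_apply_self (m : Vertex₂ S) (a : S) : step m a a = next (m a) := by
  simp [step, Vertex₂.set]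

theorem step_apply_ne (m : Vertex₂ S) {a s : S} (h : s ≠ a) : step m a s = m s := by
  simp [step, Vertex₂.set, h]

theorem step_comm (m : Vertex₂ S) {a b : S} : step (step m a) b = step (step m b) a := by
  by_cases hab : a = b
  · rw [hab]
  funext s
  by_cases ha : s = a
  · subst ha
    rw [step_apply_ne _ hab, step_apply_self, step_apply_self, step_apply_ne _ hab]
  · by_cases hb : s = b
    · subst hb
      rw [step_apply_ne _ ha, step_apply_self, step_apply_self, step_apply_ne _ ha]
    · rw [step_apply_ne _ hb, step_apply_ne _ ha, step_apply_ne _ ha, step_apply_ne _ hb]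

/-- An intermediate corner of a square agrees in each coordinate with one of the two opposite
corners, so that an object common to the subcubes at those two also occurs at the intermediate one.
-/
theorem step_step_pair (m : Vertex₂ S) {a b : S} (hab : a ≠ b) (s : S) :
    step m a s = m s ∨ step m a s = step (step m a) b s := by
  by_cases hs : s = a
  · subst hs
    exact .inr (step_apply_ne _ hab).symm
  · exact .inl (step_apply_ne _ hs)

/-- A step changes precisely the coordinate of its direction, as `next` has no fixed point. Hence
the ends of an arrow determine its direction. -/
theorem step_injective (m : Vertex₂ S) {a b : S} (h : step m a = step m b) : a = b := by
  by_contra hab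
  have h1 := congrFun h a
  rw [step_apply_self, step_apply_ne m hab] at h1
  exact next_ne _ h1

theorem forall_not_row_iff (m n : Vertex₂ S) :
    (∀ (v : Vertex₂ S) (a : S), ¬ (m = v.set a (-1) ∧ n = v.set a 0) ∧
      ¬ (m = v.set a 0 ∧ n = v.set a 1) ∧ ¬ (m = v.set a 1 ∧ n = v.set a (-1))) ↔
    ∀ a, n ≠ step m a := by
  constructor
  · intro h a ha
    rcases exists_row_of_eq_step ha with ⟨v, hv⟩ | ⟨v, hv⟩ | ⟨v, hv⟩
    · exact (h v a).1 hv
    · exact (h v a).2.1 hv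
    · exact (h v a).2.2 hv
  · intro h v a
    refine ⟨?_, ?_, ?_⟩
    · rintro ⟨rfl, rfl⟩
      exact h a (step_set_neg v a).symm
    · rintro ⟨rfl, rfl⟩
      exact h a (step_set_zero v a).symm
    · rintro ⟨rfl, rfl⟩
      exact h a (step_set_one v a).symm

end SideTwoDiagram

/-! ### The subcube at the end of a row as a cone -/

namespace Vertex₂
variable {S : Type}

theorem face_set_iff (v : Vertex₂ S) (a : S) {x : SignType} (hx : x ≠ 1) (i : Vertex S) :
    (v.set a x).Face i ↔ (v.set a 1).Face i ∧ (i a).1 = x := by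
  classical
  constructor
  · intro h
    refine ⟨fun s hs => ?_, by simpa [set, hx] using h a⟩
    have hsa : s ≠ a := by rintro rfl; simp [set] at hs
    simpa [set, hsa] using h s (by simpa [set, hsa] using hs)
  · rintro ⟨h, rfl⟩ s hs
    by_cases hsa : s = a
    · subst hsa; simp [set]
    · simpa [set, hsa] using h s (by simpa [set, hsa] using hs)

/-- Coordinate `a` of a vertex of {-1,0}^S is either -1 or 0, which distributes the objects of the
subcube at `v.set a 1` over the two earlier subcubes of the row. -/
theorem face_set_zero_iff_not {v : Vertex₂ S} {a : S} {i : Vertex S} (hi : (v.set a 1).Face i) :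
    (v.set a 0).Face i ↔ ¬ (v.set a (-1)).Face i := by
  rw [face_set_iff v a (x := 0) (by decide), face_set_iff v a (x := -1) (by decide)]
  simp only [hi, true_and]
  generalize i a = y
  revert y
  decide

end Vertex₂

theorem Vertex.not_lt_of_apply {S : Type} {i j : Vertex S} {a : S} (hi : (i a).1 = 0)
    (hj : (j a).1 = -1) : ¬ i < j := by
  intro h
  have h1 := h.le a
  have h2 : (i a).1 ≤ (j a).1 := h1
  rw [hi, hj] at h2
  exact absurd h2 (by decide)

namespace TwistedCube

theorem ne_of_face_set {S : Type} {v : Vertex₂ S} {a : S} {i j : Vertex S} (hi : (v.set a (-1)).Face i)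
    (hj : (v.set a 0).Face j) : i ≠ j := by
  rintro rfl
  rw [Vertex₂.face_set_iff v a (by decide)] at hi hj
  rw [hi.2] at hj
  exact absurd hj.2 (by decide)

section
variable {k : Type w} [CommRing k] {C : Type u} [DGCategory.{v} k C] {S : Type} [Fintype S]
  (X : TwistedCube k C S)

/-- Morphisms of a twisted cube never lower a coordinate. This accounts for the zero block of the
cone and removes all unwanted entries in the later comparisons of matrices. -/
theorem q_eq_zero_of_apply {i j : Vertex S} {a : S} (hi : (i a).1 = 0) (hj : (j a).1 = -1) :
    X.q i j = 0 := X.q_eq_zero i j (Vertex.not_lt_of_apply hi hj)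

theorem idEntry_self (i : Vertex S) : X.idEntry i i = id (k := k) (X.obj i) := by
  simp [idEntry, ofEq]

theorem idEntry_ne {i j : Vertex S} (h : i ≠ j) : X.idEntry i j = 0 := by
  simp [idEntry, h]

theorem d_idEntry (i j : Vertex S) : d (k := k) (X.idEntry i j) = 0 := by
  by_cases h : i = j
  · subst h; rw [idEntry_self]; exact (isClosedOfDeg_id _).2
  · rw [X.idEntry_ne h, map_zero]

theorem idEntry_mem {i j : Vertex S} {p : ℤ} (h : i = j → p = 0) :
    X.idEntry i j ∈ gr (k := k) (X.obj i) (X.obj j) p := by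
  by_cases hij : i = j
  · rw [h hij]; subst hij; rw [idEntry_self]; exact id_mem _
  · rw [X.idEntry_ne hij]; exact Submodule.zero_mem _

open Classical in
-- Multiplication by a matrix of identities leaves one summand, present only if its index belongs to
-- the intermediate subcube. Matrix identities thus reduce to deciding which subcubes contain given
-- vertices.
theorem sum_comp_idEntry (m : Vertex₂ S) [Fintype {i : Vertex S // m.Face i}] {A : C} (i : Vertex S)
    (G : ∀ x, Hom k (X.obj x) A) :
    ∑ x : {x : Vertex S // m.Face x}, comp (k := k) (G x.1) (X.idEntry i x.1) =
      if m.Face i then G i else 0 := by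
  rw [sum_face m (fun x => comp (k := k) (G x) (X.idEntry i x)), Finset.sum_eq_single i]
  · rw [idEntry_self, comp_id]
  · intro x _ hx
    rw [X.idEntry_ne hx.symm]
    simp
  · simp

open Classical in
theorem sum_idEntry_comp (m : Vertex₂ S) [Fintype {i : Vertex S // m.Face i}] {A : C} (j : Vertex S)
    (G : ∀ x, Hom k A (X.obj x)) :
    ∑ x : {x : Vertex S // m.Face x}, comp (k := k) (X.idEntry x.1 j) (G x.1) =
      if m.Face j then G j else 0 := by
  rw [sum_face m (fun x => comp (k := k) (X.idEntry x j) (G x)), Finset.sum_eq_single j]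
  · rw [idEntry_self, id_comp]
  · intro x _ hx
    rw [X.idEntry_ne hx]
    simp
  · simp

theorem id_sub_apply (m : Vertex₂ S) (i j : (X.sub m).ι) :
    (id (k := k) (X.sub m) : Fam.Mat k (X.sub m).toFam (X.sub m).toFam) i j =
      X.idEntry i.1 j.1 := by
  change Fam.matId k (X.sub m).toFam i j = _
  by_cases h : i = j
  · subst h
    rw [Fam.matId_self, idEntry_self]
    rfl
  · exact (Fam.matId_ne k _ h).trans (X.idEntry_ne fun h' => h (Subtype.ext h')).symm

/-- The cone lowers the positions of its source by one, which makes up for |l'| = |n'| - 1, while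
|m'| = |n'|. Each object therefore has the same position in the cone and in Y^n. -/
theorem coneTo_mem (v : Vertex₂ S) (a : S) :
    X.coneTo v a ∈ gr (k := k) (X.rowCone v a) (X.sub (v.set a 1)) 0 := by
  rintro (i | i) j
  · refine X.idEntry_mem fun h => ?_
    change 0 + ((i.1.deg - (v.set a (-1)).deg) - 1) - (j.1.deg - (v.set a 1).deg) = 0
    rw [h, deg_set_neg]; ring
  · refine X.idEntry_mem fun h => ?_
    change 0 + (i.1.deg - (v.set a 0).deg) - (j.1.deg - (v.set a 1).deg) = 0
    rw [h, deg_set_zero]; ring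

theorem coneFrom_mem (v : Vertex₂ S) (a : S) :
    X.coneFrom v a ∈ gr (k := k) (X.sub (v.set a 1)) (X.rowCone v a) 0 := by
  rintro i (j | j)
  · refine X.idEntry_mem fun h => ?_
    change 0 + (i.1.deg - (v.set a 1).deg) - ((j.1.deg - (v.set a (-1)).deg) - 1) = 0
    rw [h, deg_set_neg]; ring
  · refine X.idEntry_mem fun h => ?_
    change 0 + (i.1.deg - (v.set a 1).deg) - (j.1.deg - (v.set a 0).deg) = 0
    rw [h, deg_set_zero]; ring

theorem coneTo_comp_coneFrom (v : Vertex₂ S) (a : S) :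
    comp (k := k) (X.coneTo v a) (X.coneFrom v a) = id (k := k) (X.sub (v.set a 1)) := by
  classical
  funext i j
  refine Eq.trans ?_ (X.id_sub_apply _ i j).symm
  refine (Fintype.sum_sum_type _).trans ?_
  change ∑ x : {i : Vertex S // (v.set a (-1)).Face i},
      comp (k := k) (X.idEntry x.1 j.1) (X.idEntry i.1 x.1) +
    ∑ x : {i : Vertex S // (v.set a 0).Face i},
      comp (k := k) (X.idEntry x.1 j.1) (X.idEntry i.1 x.1) = _
  rw [X.sum_comp_idEntry (v.set a (-1)) i.1 (fun x => X.idEntry x j.1),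
    X.sum_comp_idEntry (v.set a 0) i.1 (fun x => X.idEntry x j.1)]
  have h := Vertex₂.face_set_zero_iff_not i.2
  by_cases h1 : (v.set a (-1)).Face i.1
  · rw [if_pos h1, if_neg (by rw [h]; exact not_not.2 h1), add_zero]
  · rw [if_neg h1, if_pos (h.2 h1), zero_add]

theorem coneFrom_comp_coneTo (v : Vertex₂ S) (a : S) :
    comp (k := k) (X.coneFrom v a) (X.coneTo v a) = id (k := k) (X.rowCone v a) := by
  classical
  have hl {i} (hi : (v.set a (-1)).Face i) := ((Vertex₂.face_set_iff v a (by decide) i).1 hi).1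
  have hm {i} (hi : (v.set a 0).Face i) := ((Vertex₂.face_set_iff v a (by decide) i).1 hi).1
  funext i j
  change _ = Fam.matId k (X.rowCone v a).toFam i j
  rcases i with i | i <;> rcases j with j | j <;>
    refine (X.sum_comp_idEntry (v.set a 1) i.1 (fun x => X.idEntry x j.1)).trans ?_
  · rw [if_pos (hl i.2)]
    by_cases h : i = j
    · subst h
      exact (X.idEntry_self _).trans (Fam.matId_self k (X.rowCone v a).toFam (Sum.inl i)).symm
    · exact (X.idEntry_ne fun h' => h (Subtype.ext h')).trans
        (Fam.matId_ne k (X.rowCone v a).toFam (fun h' => h (Sum.inl_injective h'))).symm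
  · rw [if_pos (hl i.2)]
    exact (X.idEntry_ne (ne_of_face_set i.2 j.2)).trans
      (Fam.matId_ne k (X.rowCone v a).toFam Sum.inl_ne_inr).symm
  · rw [if_pos (hm i.2)]
    exact (X.idEntry_ne (ne_of_face_set j.2 i.2).symm).trans
      (Fam.matId_ne k (X.rowCone v a).toFam Sum.inr_ne_inl).symm
  · rw [if_pos (hm i.2)]
    by_cases h : i = j
    · subst h
      exact (X.idEntry_self _).trans (Fam.matId_self k (X.rowCone v a).toFam (Sum.inr i)).symm
    · exact (X.idEntry_ne fun h' => h (Subtype.ext h')).trans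
        (Fam.matId_ne k (X.rowCone v a).toFam (fun h' => h (Sum.inr_injective h'))).symm

/-- The twisted maps of the cone are those of Y^n, block by block. On the l-part the sign change
made by the cone cancels (-1)^|l'| = -(-1)^|n'|; the mixed block is `rowMap`, defined with the sign
of n; on the m-part the signs agree; from the m-part to the l-part both sides vanish. -/
theorem coneTo_closed (v : Vertex₂ S) (a : S) : IsClosedOfDeg k 0 (X.coneTo v a) := by
  classical
  have hl {i} (hi : (v.set a (-1)).Face i) := (Vertex₂.face_set_iff v a (by decide) i).1 hi
  have hm {i} (hi : (v.set a 0).Face i) := (Vertex₂.face_set_iff v a (by decide) i).1 hi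
  refine ⟨X.coneTo_mem v a, ?_⟩
  funext i j
  rw [TwistedComplex.d_apply k (X.coneTo_mem v a)]
  have hj := Vertex₂.face_set_zero_iff_not j.2
  rcases i with i | i
  · refine (congrArg (fun z => _ - sgn k 0 • z) (Fintype.sum_sum_type _)).trans ?_
    change sgn k _ • d (k := k) (X.idEntry i.1 j.1) +
      ∑ x : {i : Vertex S // (v.set a 1).Face i},
        comp (k := k) (sgn k (v.set a 1).deg • X.q x.1 j.1) (X.idEntry i.1 x.1) -
      sgn k 0 • (∑ x : {i : Vertex S // (v.set a (-1)).Face i},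
        comp (k := k) (X.idEntry x.1 j.1) (-(sgn k (v.set a (-1)).deg • X.q i.1 x.1)) +
        ∑ x : {i : Vertex S // (v.set a 0).Face i},
        comp (k := k) (X.idEntry x.1 j.1) (sgn k (v.set a 1).deg • X.q i.1 x.1)) = 0
    rw [X.sum_comp_idEntry (v.set a 1) i.1 (fun x => sgn k (v.set a 1).deg • X.q x j.1),
      X.sum_idEntry_comp (v.set a (-1)) j.1 (fun x => -(sgn k (v.set a (-1)).deg • X.q i.1 x)),
      X.sum_idEntry_comp (v.set a 0) j.1 (fun x => sgn k (v.set a 1).deg • X.q i.1 x),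
      d_idEntry, if_pos (hl i.2).1, deg_set_neg, sgn_sub, sgn_one, sgn_zero]
    by_cases h1 : (v.set a (-1)).Face j.1
    · rw [if_pos h1, if_neg (by rw [hj]; exact not_not.2 h1)]
      simp
    · rw [if_neg h1, if_pos (hj.2 h1)]
      simp
  · refine (congrArg (fun z => _ - sgn k 0 • z) (Fintype.sum_sum_type _)).trans ?_
    change sgn k _ • d (k := k) (X.idEntry i.1 j.1) +
      ∑ x : {i : Vertex S // (v.set a 1).Face i},
        comp (k := k) (sgn k (v.set a 1).deg • X.q x.1 j.1) (X.idEntry i.1 x.1) -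
      sgn k 0 • (∑ x : {i : Vertex S // (v.set a (-1)).Face i},
        comp (k := k) (X.idEntry x.1 j.1) (0 : Hom k (X.obj i.1) (X.obj x.1)) +
        ∑ x : {i : Vertex S // (v.set a 0).Face i},
        comp (k := k) (X.idEntry x.1 j.1) (sgn k (v.set a 0).deg • X.q i.1 x.1)) = 0
    rw [X.sum_comp_idEntry (v.set a 1) i.1 (fun x => sgn k (v.set a 1).deg • X.q x j.1),
      X.sum_idEntry_comp (v.set a 0) j.1 (fun x => sgn k (v.set a 0).deg • X.q i.1 x),
      d_idEntry, if_pos (hm i.2).1, deg_set_zero, sgn_zero]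
    by_cases h1 : (v.set a (-1)).Face j.1
    · rw [if_neg (by rw [hj]; exact not_not.2 h1), X.q_eq_zero_of_apply (hm i.2).2 (hl h1).2]
      simp
    · rw [if_pos (hj.2 h1)]
      simp

theorem coneFrom_closed (v : Vertex₂ S) (a : S) : IsClosedOfDeg k 0 (X.coneFrom v a) :=
  ⟨X.coneFrom_mem v a, eq_zero_of_closed_isomorphism (X.coneTo_closed v a) (X.coneFrom_mem v a)
    (X.coneFrom_comp_coneTo v a) (X.coneTo_comp_coneFrom v a)⟩

/-! ### The arrows of a row as matrices between subcubes -/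

/-- The submatrix of a matrix of morphisms between the objects of `X` with rows in the subcube at
`m` and columns in the one at `n`. -/
def ofEntries (m n : Vertex₂ S) (G : ∀ i j, Hom k (X.obj i) (X.obj j)) :
    Hom k (X.sub m) (X.sub n) :=
  fun i j => G i.1 j.1

open Classical in
theorem ofEntries_comp_apply (l m n : Vertex₂ S) (G H : ∀ i j, Hom k (X.obj i) (X.obj j))
    (i : (X.sub l).ι) (j : (X.sub n).ι) :
    (comp (k := k) (X.ofEntries m n G) (X.ofEntries l m H) :
      Fam.Mat k (X.sub l).toFam (X.sub n).toFam) i j =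
        ∑ x, if m.Face x then comp (k := k) (G x j.1) (H i.1 x) else 0 :=
  sum_face m (fun x => comp (k := k) (G x j.1) (H i.1 x))

/-- The matrix whose entries are the identities of those objects which occur both in the subcube at
`m` and in the one at `n`. -/
noncomputable def idMap (m n : Vertex₂ S) : Hom k (X.sub m) (X.sub n) :=
  X.ofEntries m n X.idEntry

theorem idMap_mem (m n : Vertex₂ S) :
    X.idMap m n ∈ gr (k := k) (X.sub m) (X.sub n) (m.deg - n.deg) := by
  intro i j
  refine X.idEntry_mem fun h => ?_
  change m.deg - n.deg + (i.1.deg - m.deg) - (j.1.deg - n.deg) = 0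
  rw [h]; ring

open Classical in
-- Identities are closed, so only the commutator with the twisted maps remains, and (-1)^(|m'|-|n'|)
-- (-1)^|m'| = (-1)^|n'| gives both terms the same factor. The formula yields the closedness of the
-- edges as well as the null-homotopies for two successive edges.
theorem d_idMap_apply (m n : Vertex₂ S) (i : (X.sub m).ι) (j : (X.sub n).ι) :
    (d (k := k) (X.idMap m n) : Fam.Mat k (X.sub m).toFam (X.sub n).toFam) i j =
      sgn k n.deg • ((if n.Face i.1 then X.q i.1 j.1 else 0) -
        if m.Face j.1 then X.q i.1 j.1 else 0) := by
  rw [TwistedComplex.d_apply k (X.idMap_mem m n)]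
  change sgn k _ • d (k := k) (X.idEntry i.1 j.1) +
    ∑ x : {i : Vertex S // n.Face i},
      comp (k := k) (sgn k n.deg • X.q x.1 j.1) (X.idEntry i.1 x.1) -
    sgn k (m.deg - n.deg) • ∑ x : {i : Vertex S // m.Face i},
      comp (k := k) (X.idEntry x.1 j.1) (sgn k m.deg • X.q i.1 x.1) = _
  rw [X.sum_comp_idEntry n i.1 (fun x => sgn k n.deg • X.q x j.1),
    X.sum_idEntry_comp m j.1 (fun x => sgn k m.deg • X.q i.1 x), d_idEntry, smul_zero, zero_add,
    smul_sub, smul_ite, smul_ite, smul_ite, smul_zero, smul_zero, smul_smul, sgn_sub,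
    mul_right_comm, sgn_mul_self, one_mul]

open Classical in
theorem idMap_comp_apply (l m n : Vertex₂ S) (G : ∀ i j, Hom k (X.obj i) (X.obj j))
    (i : (X.sub l).ι) (j : (X.sub n).ι) :
    (comp (k := k) (X.idMap m n) (X.ofEntries l m G) :
      Fam.Mat k (X.sub l).toFam (X.sub n).toFam) i j = if m.Face j.1 then G i.1 j.1 else 0 :=
  X.sum_idEntry_comp m j.1 (fun x => G i.1 x)

open Classical in
theorem comp_idMap_apply (l m n : Vertex₂ S) (G : ∀ i j, Hom k (X.obj i) (X.obj j))
    (i : (X.sub l).ι) (j : (X.sub n).ι) :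
    (comp (k := k) (X.ofEntries m n G) (X.idMap l m) :
      Fam.Mat k (X.sub l).toFam (X.sub n).toFam) i j = if m.Face i.1 then G i.1 j.1 else 0 :=
  X.sum_comp_idEntry m i.1 (fun x => G x j.1)

open Classical in
/-- The morphism along a row in direction `a` from the total complex of the sign-twisted subcube
at `m` to the one at the vertex `n` following `m` in this row. -/
noncomputable def edge (m n : Vertex₂ S) (a : S) : Hom k (X.sub m) (X.sub n) :=
  if m a = -1 then X.ofEntries m n (fun i j => -(sgn k m.deg • X.q i j)) else X.idMap m n

theorem edge_of_eq {m : Vertex₂ S} {a : S} (h : m a = -1) (n : Vertex₂ S) :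
    X.edge m n a = X.ofEntries m n (fun i j => -(sgn k m.deg • X.q i j)) := if_pos h

theorem edge_of_ne {m : Vertex₂ S} {a : S} (h : m a ≠ -1) (n : Vertex₂ S) :
    X.edge m n a = X.idMap m n := if_neg h

/-- As |n'| = |l'| + 1, the sign (-1)^|n'| equals -(-1)^|l'|. In this form the sign involves only
the starting vertex. -/
theorem rowMap_eq_edge (v : Vertex₂ S) (a : S) :
    X.rowMap v a = X.edge (v.set a (-1)) (v.set a 0) a := by
  rw [X.edge_of_eq (by simp [Vertex₂.set])]
  funext i j
  change _ = -(sgn k (v.set a (-1)).deg • X.q i.1 j.1)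
  rw [deg_set_neg, sgn_sub, sgn_one]
  simp only [rowMap, mul_neg, mul_one, neg_smul, neg_neg]

/-- Together with `coneOut_comp_coneFrom` this removes the cone from the description of a row: the
two arrows at n are matrices of identities. -/
theorem coneTo_comp_coneIn (v : Vertex₂ S) (a : S) :
    comp (k := k) (X.coneTo v a) (TwistedComplex.coneIn k (X.rowMap v a)
      (X.rowMap_closed v a).1 (X.rowMap_closed v a).2) = X.edge (v.set a 0) (v.set a 1) a := by
  classical
  rw [X.edge_of_ne (by simp [Vertex₂.set])]
  funext i j
  refine (Fintype.sum_sum_type _).trans ?_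
  refine (congrArg (fun z => _ + z)
    (Finset.sum_congr rfl fun x _ => congrArg _ (X.id_sub_apply (v.set a 0) i x))).trans ?_
  change ∑ x : {i : Vertex S // (v.set a (-1)).Face i},
      comp (k := k) (X.idEntry x.1 j.1) (0 : Hom k (X.obj i.1) (X.obj x.1)) +
    ∑ x : {i : Vertex S // (v.set a 0).Face i},
      comp (k := k) (X.idEntry x.1 j.1) (X.idEntry i.1 x.1) = _
  simp only [map_zero, Finset.sum_const_zero, zero_add]
  rw [X.sum_comp_idEntry (v.set a 0) i.1 (fun x => X.idEntry x j.1), if_pos i.2]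
  rfl

theorem coneOut_comp_coneFrom (v : Vertex₂ S) (a : S) :
    comp (k := k) (TwistedComplex.coneOut k (X.rowMap v a)
      (X.rowMap_closed v a).1 (X.rowMap_closed v a).2) (X.coneFrom v a) =
        X.edge (v.set a 1) (v.set a (-1)) a := by
  classical
  rw [X.edge_of_ne (by simp [Vertex₂.set])]
  funext i j
  refine (Fintype.sum_sum_type _).trans ?_
  refine (congrArg (fun z => z + _) (Finset.sum_congr rfl fun x _ =>
    congrArg (fun z => comp (k := k) z _) (X.id_sub_apply (v.set a (-1)) x j))).trans ?_
  change ∑ x : {i : Vertex S // (v.set a (-1)).Face i},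
      comp (k := k) (X.idEntry x.1 j.1) (X.idEntry i.1 x.1) +
    ∑ x : {i : Vertex S // (v.set a 0).Face i},
      comp (k := k) (0 : Hom k (X.obj x.1) (X.obj j.1)) (X.idEntry i.1 x.1) = _
  simp only [map_zero, LinearMap.zero_apply, Finset.sum_const_zero, add_zero]
  rw [X.sum_idEntry_comp (v.set a (-1)) j.1 (fun x => X.idEntry i.1 x), if_pos j.2]
  rfl

/-- The objects with coordinate 0 form a subcomplex of Y^n: the twisted maps from them to the
objects with coordinate -1 vanish. -/
theorem edge_closed_of_zero (v : Vertex₂ S) (a : S) :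
    IsClosedOfDeg k 0 (X.edge (v.set a 0) (v.set a 1) a) := by
  classical
  rw [X.edge_of_ne (by simp [Vertex₂.set])]
  refine ⟨by simpa [deg_set_zero] using X.idMap_mem (v.set a 0) (v.set a 1), ?_⟩
  funext i j
  rw [X.d_idMap_apply]
  have hi := (Vertex₂.face_set_iff v a (by decide) _).1 i.2
  rw [if_pos hi.1]
  by_cases h1 : (v.set a 0).Face j.1
  · rw [if_pos h1, sub_self, smul_zero]
    rfl
  · rw [Vertex₂.face_set_zero_iff_not j.2, not_not] at h1
    rw [X.q_eq_zero_of_apply hi.2 ((Vertex₂.face_set_iff v a (by decide) _).1 h1).2]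
    simp only [ite_self, sub_self, smul_zero]
    rfl

/-- Dually to `edge_closed_of_zero`, the objects with coordinate -1 form a quotient of Y^n. -/
theorem edge_closed_of_one (v : Vertex₂ S) (a : S) :
    IsClosedOfDeg k 1 (X.edge (v.set a 1) (v.set a (-1)) a) := by
  classical
  rw [X.edge_of_ne (by simp [Vertex₂.set])]
  refine ⟨by simpa [deg_set_neg] using X.idMap_mem (v.set a 1) (v.set a (-1)), ?_⟩
  funext i j
  rw [X.d_idMap_apply]
  have hj := (Vertex₂.face_set_iff v a (by decide) _).1 j.2
  rw [if_pos hj.1]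
  by_cases h1 : (v.set a (-1)).Face i.1
  · rw [if_pos h1, sub_self, smul_zero]
    rfl
  · rw [← Vertex₂.face_set_zero_iff_not i.2, Vertex₂.face_set_iff v a (by decide)] at h1
    rw [X.q_eq_zero_of_apply h1.2 hj.2]
    simp only [ite_self, sub_self, smul_zero]
    rfl

open SideTwoDiagram in
theorem edge_closed {m n : Vertex₂ S} {a : S} (h : n = step m a) :
    IsClosedOfDeg k (if m a = 1 then 1 else 0) (X.edge m n a) := by
  rcases exists_row_of_eq_step h with ⟨v, rfl, rfl⟩ | ⟨v, rfl, rfl⟩ | ⟨v, rfl, rfl⟩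
  · rw [if_neg (by simp [Vertex₂.set]), ← rowMap_eq_edge]
    exact X.rowMap_closed v a
  · rw [if_neg (by simp [Vertex₂.set])]
    exact X.edge_closed_of_zero v a
  · rw [if_pos (by simp [Vertex₂.set])]
    exact X.edge_closed_of_one v a

end

end TwistedCube

/-! ### Completions described by edges -/

namespace SideTwoDiagram
variable {k : Type w} [CommRing k] {C : Type u} [DGCategory.{v} k C] {S : Type} [Fintype S]

open TwistedComplex in
-- The three closedness conditions and the three row conditions collapse into one condition per
-- step; the degree is 1 precisely for the wrap-around step.
theorem isCompletion_iff {L : Level} {X : TwistedCube k C S} {Z : SideTwoDiagram k C S}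
    {θ : ∀ m, Hom k (single k (Z.obj m)) (X.sub m)} :
    Z.IsCompletion L X θ ↔ (∀ m, IsEquivalence k L (θ m)) ∧
      (∀ m n a, n = step m a → IsClosedOfDeg k (if m a = 1 then 1 else 0) (Z.r m n) ∧
        Same k L (comp (k := k) (θ n) (singleMap k (Z.r m n)))
          (comp (k := k) (X.edge m n a) (θ m))) ∧
      ∀ m n, (∀ a, n ≠ step m a) → Z.r m n = 0 := by
  constructor
  · intro h
    refine ⟨h.equivalence, fun m n a hn => ?_,
      fun m n hmn => h.zero m n ((forall_not_row_iff m n).2 hmn)⟩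
    rcases exists_row_of_eq_step hn with ⟨v, rfl, rfl⟩ | ⟨v, rfl, rfl⟩ | ⟨v, rfl, rfl⟩
    · rw [if_neg (by simp [Vertex₂.set]), ← X.rowMap_eq_edge]
      exact ⟨h.closed₁ v a, h.row₁ v a⟩
    · rw [if_neg (by simp [Vertex₂.set]), ← X.coneTo_comp_coneIn, assoc]
      exact ⟨h.closed₂ v a, h.row₂ v a⟩
    · rw [if_pos (by simp [Vertex₂.set]), ← X.coneOut_comp_coneFrom, assoc]
      exact ⟨h.closed₃ v a, h.row₃ v a⟩
  · rintro ⟨h1, h2, h3⟩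
    have h2₁ := fun v a => h2 _ _ _ (step_set_neg v a).symm
    have h2₂ := fun v a => h2 _ _ _ (step_set_zero v a).symm
    have h2₃ := fun v a => h2 _ _ _ (step_set_one v a).symm
    refine ⟨h1, fun v a => ?_, fun v a => ?_, fun v a => ?_, fun v a => ?_, fun v a => ?_,
      fun v a => ?_, fun m n hmn => h3 m n ((forall_not_row_iff m n).1 hmn)⟩
    · have := (h2₁ v a).1
      rwa [if_neg (by simp [Vertex₂.set])] at this
    · have := (h2₂ v a).1
      rwa [if_neg (by simp [Vertex₂.set])] at this
    · have := (h2₃ v a).1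
      rwa [if_pos (by simp [Vertex₂.set])] at this
    · rw [X.rowMap_eq_edge]
      exact (h2₁ v a).2
    · rw [← assoc, X.coneTo_comp_coneIn]
      exact (h2₂ v a).2
    · rw [← assoc, X.coneOut_comp_coneFrom]
      exact (h2₃ v a).2

end SideTwoDiagram

end DGCategory

/-! ### Existence, uniqueness and exactness of the rows -/

namespace DGCategory
namespace SideTwoDiagram
variable {k : Type w} [CommRing k] {C : Type u} [DGCategory.{v} k C] {S : Type} [Fintype S]
  {L : Level} {X : TwistedCube k C S}

open TwistedComplex

/-- The edges are conjugated by the equivalences `θ` and their inverses `ξ`, and the results lie in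
`C` by fullness. -/
theorem exists_isCompletion (hC : IsPretriangulated k C L) (X : TwistedCube k C S) :
    ∃ (Z : SideTwoDiagram k C S) (θ : ∀ m, Hom k (single k (Z.obj m)) (X.sub m)),
      Z.IsCompletion L X θ := by
  classical
  choose Y θ hθ using fun m => hC (X.sub m) (X.sub_isOneSided m)
  have hθ' := fun m => (hθ m).2
  choose ξ hξ hξθ hθξ using hθ'
  have hr : ∀ m n, ∃ r : Hom k (Y m) (Y n), (∀ a, n = step m a →
      singleMap k r = comp (k := k) (ξ n) (comp (k := k) (X.edge m n a) (θ m))) ∧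
      ((∀ a, n ≠ step m a) → r = 0) := by
    intro m n
    by_cases h : ∃ a, n = step m a
    · obtain ⟨a, ha⟩ := h
      obtain ⟨r, hr⟩ :=
        exists_singleMap_eq (comp (k := k) (ξ n) (comp (k := k) (X.edge m n a) (θ m)))
      refine ⟨r, fun b hb => ?_, fun h => absurd ha (h a)⟩
      -- The edge chosen for (m, n) does not depend on the direction, since the ends determine it.
      obtain rfl := step_injective m (ha.symm.trans hb)
      exact hr
    · exact ⟨0, fun a ha => absurd ⟨a, ha⟩ h, fun _ => rfl⟩
  choose r hr₁ hr₂ using hr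
  refine ⟨⟨Y, r⟩, θ, isCompletion_iff.2 ⟨hθ, fun m n a hn => ⟨?_, ?_⟩, hr₂⟩⟩
  · rw [← isClosedOfDeg_singleMap]
    change IsClosedOfDeg k _ (singleMap k (r m n))
    rw [hr₁ m n a hn]
    simpa using (hξ n).comp ((X.edge_closed hn).comp (hθ m).1)
  · change Same k L (comp (k := k) (θ n) (singleMap k (r m n))) _
    rw [hr₁ m n a hn, ← assoc]
    have h := (hθξ n).comp_right ((X.edge_closed hn).comp (hθ m).1)
    rwa [id_comp] at h

section
variable {Z Z' : SideTwoDiagram k C S} {θ : ∀ m, Hom k (single k (Z.obj m)) (X.sub m)}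
  {θ' : ∀ m, Hom k (single k (Z'.obj m)) (X.sub m)}

/-- The condition on φ forces it to be an inverse of `θ'` composed with `θ`. Both the intertwining
relation and the uniqueness are checked after composing with `θ'`, where they follow from the row
conditions. -/
theorem exists_unique_equivalence (hZ : Z.IsCompletion L X θ) (hZ' : Z'.IsCompletion L X θ') :
    ∃ φ : ∀ m, Hom k (Z.obj m) (Z'.obj m),
      (∀ m, IsEquivalence k L (φ m) ∧
        Same k L (comp (k := k) (θ' m) (singleMap k (φ m))) (θ m)) ∧
      (∀ l m, Same k L (comp (k := k) (φ m) (Z.r l m)) (comp (k := k) (Z'.r l m) (φ l))) ∧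
      (∀ m (ψ : Hom k (Z.obj m) (Z'.obj m)), IsClosedOfDeg k 0 ψ →
        Same k L (comp (k := k) (θ' m) (singleMap k ψ)) (θ m) → Same k L ψ (φ m)) := by
  rw [isCompletion_iff] at hZ hZ'
  obtain ⟨hθ, hr, h0⟩ := hZ
  obtain ⟨hθ', hr', h0'⟩ := hZ'
  have hφ : ∀ m, ∃ φ : Hom k (Z.obj m) (Z'.obj m), IsEquivalence k L φ ∧
      Same k L (comp (k := k) (θ' m) (singleMap k φ)) (θ m) := by
    intro m
    obtain ⟨hc, ξ, hξ, h1, h2⟩ := hθ' m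
    obtain ⟨φ, hφ⟩ := exists_singleMap_eq (comp (k := k) ξ (θ m))
    refine ⟨φ, ?_, ?_⟩
    · rw [← isEquivalence_singleMap, hφ]
      exact IsEquivalence.comp ⟨hξ, θ' m, hc, h2, h1⟩ (hθ m)
    · rw [hφ, ← assoc]
      have h := h2.comp_right (hθ m).1
      rwa [id_comp] at h
  choose φ hφ using hφ
  refine ⟨φ, hφ, fun l m => ?_, fun m ψ hψ hs => ?_⟩
  · by_cases h : ∃ a, m = step l a
    · obtain ⟨a, ha⟩ := h
      obtain ⟨hc, hs⟩ := hr l m a ha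
      obtain ⟨hc', hs'⟩ := hr' l m a ha
      have hsc := isClosedOfDeg_singleMap.2 hc
      have hsc' := isClosedOfDeg_singleMap.2 hc'
      have hφl := isClosedOfDeg_singleMap.2 (hφ l).1.1
      have hφm := isClosedOfDeg_singleMap.2 (hφ m).1.1
      rw [← same_singleMap, singleMap_comp, singleMap_comp]
      refine (hθ' m).cancel_left (hφm.comp hsc) (hsc'.comp hφl) ?_
      have e1 := (hφ m).2.comp_right hsc
      have e2 := hs'.comp_right hφl
      have e3 := (hφ l).2.comp_left (X.edge_closed ha)
      rw [assoc] at e1 e2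
      rw [assoc] at e2
      exact (e1.trans hs).trans (e2.trans e3).symm
    · have h' : ∀ a, m ≠ step l a := fun a ha => h ⟨a, ha⟩
      refine Same.of_eq L ?_
      rw [h0 l m h', h0' l m h']
      simp
  · rw [← same_singleMap]
    exact (hθ' m).cancel_left (isClosedOfDeg_singleMap.2 hψ)
      (isClosedOfDeg_singleMap.2 (hφ m).1.1) (hs.trans (hφ m).2.symm)

theorem IsCompletion.isExactTriangle (hZ : Z.IsCompletion L X θ) (v : Vertex₂ S) (a : S) :
    IsExactTriangle k (Z.r (v.set a (-1)) (v.set a 0)) (Z.r (v.set a 0) (v.set a 1))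
      (Z.r (v.set a 1) (v.set a (-1))) := by
  have hFrom : IsEquivalence k .homotopy (X.coneFrom v a) :=
    ⟨X.coneFrom_closed v a, X.coneTo v a, X.coneTo_closed v a,
      Same.of_eq _ (X.coneTo_comp_coneFrom v a), Same.of_eq _ (X.coneFrom_comp_coneTo v a)⟩
  refine ⟨hZ.closed₁ v a, hZ.closed₂ v a, hZ.closed₃ v a, X.sub (v.set a (-1)), X.sub (v.set a 0),
    X.rowMap v a, X.rowMap_closed v a, θ _, θ _, comp (k := k) (X.coneFrom v a) (θ _),
    (hZ.equivalence _).homotopy, (hZ.equivalence _).homotopy,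
    hFrom.comp (hZ.equivalence _).homotopy, Same.homotopic (hZ.row₁ v a), ?_, Same.homotopic (hZ.row₃ v a)⟩
  -- The row condition lands in Y^n, whereas the triangle requires the cone; `coneFrom` carries one
  -- to the other.
  have h := (Same.homotopic (hZ.row₂ v a)).comp_left (X.coneFrom_closed v a)
  rw [← assoc, ← assoc (X.coneFrom v a) (X.coneTo v a), X.coneFrom_comp_coneTo, id_comp] at h
  exact h

end

end SideTwoDiagram

end DGCategory

/-! ### Squares of edges and successive edges -/

namespace DGCategory

theorem Vertex.face_of_mem_pair {S : Type} {m n x : Vertex₂ S} {i : Vertex S} (hm : m.Face i)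
    (hn : n.Face i) (h : ∀ s, x s = m s ∨ x s = n s) : x.Face i := by
  intro s hs
  rcases h s with h1 | h1
  · rw [h1] at hs ⊢; exact hm s hs
  · rw [h1] at hs ⊢; exact hn s hs

theorem Vertex.face_of_eq_of_ne {S : Type} {m x : Vertex₂ S} {i : Vertex S} {b : S}
    (hm : m.Face i) (h : ∀ s, s ≠ b → x s = m s) (hb : x b ≠ 1 → (i b).1 = x b) : x.Face i := by
  intro s hs
  by_cases hsb : s = b
  · subst hsb; exact hb hs
  · rw [h s hsb] at hs ⊢; exact hm s hs

theorem Vertex.apply_eq_neg_one {S : Type} {i : Vertex S} {b : S} (h : (i b).1 ≠ 0) :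
    (i b).1 = -1 := by
  generalize i b = y at *
  revert y; decide

theorem Vertex.apply_eq_zero {S : Type} {i : Vertex S} {b : S} (h : (i b).1 ≠ -1) :
    (i b).1 = 0 := by
  generalize i b = y at *
  revert y; decide

namespace TwistedCube
variable {k : Type w} [CommRing k] {C : Type u} [DGCategory.{v} k C] {S : Type} [Fintype S]
  (X : TwistedCube k C S)

open SideTwoDiagram

theorem deg_step_of_neg {m : Vertex₂ S} {a : S} (h : m a = -1) :
    (step m a).deg = m.deg + 1 := by
  classical
  have hm : m = m.set a (-1) := by rw [← h]; exact (Function.update_eq_self a m).symm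
  rw [hm, step_set_neg, deg_set_zero, deg_set_neg]; ring

theorem deg_step_of_zero {m : Vertex₂ S} {a : S} (h : m a = 0) : (step m a).deg = m.deg := by
  classical
  have hm : m = m.set a 0 := by rw [← h]; exact (Function.update_eq_self a m).symm
  rw [hm, step_set_zero, deg_set_zero]

theorem deg_step_of_one {m : Vertex₂ S} {a : S} (h : m a = 1) :
    (step m a).deg = m.deg - 1 := by
  classical
  have hm : m = m.set a 1 := by rw [← h]; exact (Function.update_eq_self a m).symm
  rw [hm, step_set_one, deg_set_neg]

/-- Both composites consist of the identities of the objects common to the subcubes at m and n,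
because each such object also occurs at the intermediate vertex. -/
theorem idMap_comm {m x y n : Vertex₂ S} (hx : ∀ s, x s = m s ∨ x s = n s)
    (hy : ∀ s, y s = m s ∨ y s = n s) :
    comp (k := k) (X.idMap x n) (X.idMap m x) = comp (k := k) (X.idMap y n) (X.idMap m y) := by
  classical
  funext i j
  refine (X.idMap_comp_apply m x n X.idEntry i j).trans
    (Eq.trans ?_ (X.idMap_comp_apply m y n X.idEntry i j).symm)
  by_cases h : i.1 = j.1
  · have hm : m.Face j.1 := h ▸ i.2
    rw [if_pos (Vertex.face_of_mem_pair hm j.2 hx), if_pos (Vertex.face_of_mem_pair hm j.2 hy)]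
  · rw [X.idEntry_ne h, ite_self, ite_self]

/-- Both composites have entries ± `X.q i j`. Where the intermediate subcube would suppress an entry
on one side only, coordinate b drops from 0 to -1 and the entry is zero anyway. The step 0 → 1 in
direction b preserves |m'|, giving sign 1; the step 1 → -1 lowers it by one, giving sign -1. -/
theorem edge_comm_of_neg_of_ne (m : Vertex₂ S) {a b : S} (hab : a ≠ b) (ha : m a = -1)
    (hb : m b ≠ -1) : ∃ ε : ℤˣ,
    comp (k := k) (X.edge (step m a) (step (step m a) b) b) (X.edge m (step m a) a) =
      (ε : ℤ) • comp (k := k) (X.edge (step m b) (step (step m a) b) a)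
        (X.edge m (step m b) b) := by
  classical
  have hxb : step m a b = m b := step_apply_ne _ hab.symm
  have hya : step m b a = m a := step_apply_ne _ hab
  have hyb : step m b b = next (m b) := step_apply_self _ _
  have hnb : step (step m a) b b = next (m b) := by rw [step_apply_self, hxb]
  rw [X.edge_of_eq ha, X.edge_of_eq (hya.trans ha), X.edge_of_ne hb,
    X.edge_of_ne (by rwa [hxb] : step m a b ≠ -1)]
  have hx : ∀ s, s ≠ b → step m a s = step (step m a) b s := fun s hs => (step_apply_ne _ hs).symm
  have hy : ∀ s, s ≠ b → step m b s = m s := fun s hs => step_apply_ne _ hs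
  rcases (by clear hxb hyb hnb; generalize m b = x at *; revert x; decide : m b = 0 ∨ m b = 1) with h | h
  · refine ⟨1, ?_⟩
    rw [Units.val_one, one_zsmul]
    funext i j
    refine (X.idMap_comp_apply _ _ _ _ i j).trans
      (Eq.trans ?_ (X.comp_idMap_apply _ _ _ _ i j).symm)
    rw [if_pos (Vertex.face_of_eq_of_ne i.2 hy (by rw [hyb, h]; exact fun h => absurd rfl h)),
      deg_step_of_zero h]
    by_cases hj : (j.1 b).1 = 0
    · rw [if_pos (Vertex.face_of_eq_of_ne j.2 hx (by rw [hxb, h]; exact fun _ => hj))]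
    · rw [X.q_eq_zero_of_apply ((i.2 b (by rw [h]; decide)).trans h) (Vertex.apply_eq_neg_one hj),
        smul_zero, neg_zero, ite_self]
  · refine ⟨-1, ?_⟩
    rw [Units.val_neg, Units.val_one, neg_one_zsmul]
    funext i j
    refine (X.idMap_comp_apply _ _ _ _ i j).trans
      (Eq.trans ?_ (congrArg Neg.neg (X.comp_idMap_apply _ _ _ _ i j)).symm)
    rw [if_pos (Vertex.face_of_eq_of_ne j.2 hx (by rw [hxb, h]; exact fun h => absurd rfl h)),
      deg_step_of_one h, sgn_sub, sgn_one]
    by_cases hi : (i.1 b).1 = -1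
    · rw [if_pos (Vertex.face_of_eq_of_ne i.2 hy (by rw [hyb, h]; exact fun _ => hi))]
      simp only [mul_neg, mul_one, neg_smul, neg_neg]
      rfl
    · have hj := j.2 b (by rw [hnb, h]; decide)
      rw [hnb, h] at hj
      rw [X.q_eq_zero_of_apply (Vertex.apply_eq_zero hi) hj]
      simp only [smul_zero, neg_zero, ite_self]
      exact neg_zero.symm

open Classical in
-- A vertex strictly between i and j has its coordinates outside a and b fixed where m is not 1, and
-- its pair of coordinates at a and b selects exactly one of the four corners of the square.
theorem sum_faces (m : Vertex₂ S) {a b : S} (hab : a ≠ b) (ha : m a = -1) (hb : m b = -1)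
    {A : Type*} [AddCommMonoid A] {i j : Vertex S} (hi : m.Face i) (hj : (step (step m a) b).Face j)
    (F : Vertex S → A) (hF : ∀ x, ¬ (i < x ∧ x < j) → F x = 0) :
    (∑ x, if (step m a).Face x then F x else 0) + (∑ x, if (step m b).Face x then F x else 0) +
      ((∑ x, if (step (step m a) b).Face x then F x else 0) + ∑ x, if m.Face x then F x else 0) =
    ∑ x, F x := by
  rw [← Finset.sum_add_distrib, ← Finset.sum_add_distrib, ← Finset.sum_add_distrib]
  refine Finset.sum_congr rfl fun x _ => ?_
  by_cases hx : i < x ∧ x < j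
  swap
  · simp [hF x hx]
  have hxs : ∀ s, s ≠ a → s ≠ b → m s ≠ 1 → (x s).1 = m s := by
    intro s hsa hsb hs
    have hj' := hj s (by rwa [step_apply_ne _ hsb, step_apply_ne _ hsa])
    rw [step_apply_ne _ hsb, step_apply_ne _ hsa] at hj'
    exact le_antisymm (hj' ▸ hx.2.le s) (hi s hs ▸ hx.1.le s)
  have key : ∀ (y : Vertex₂ S) (e f : SignType), (∀ s, s ≠ a → s ≠ b → y s = m s) → y a = e →
      y b = f → e ≠ 1 → f ≠ 1 → (y.Face x ↔ (x a).1 = e ∧ (x b).1 = f) := by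
    rintro y e f hy rfl rfl he hf
    refine ⟨fun h => ⟨h a he, h b hf⟩, fun h s hs => ?_⟩
    by_cases hsa : s = a
    · subst hsa; exact h.1
    · by_cases hsb : s = b
      · subst hsb; exact h.2
      · rw [hy s hsa hsb] at hs ⊢
        exact hxs s hsa hsb hs
  have h0 : next (-1) = 0 := by decide
  rw [if_congr (key (step m a) 0 (-1) (fun s h1 _ => step_apply_ne _ h1)
      (by rw [step_apply_self, ha, h0]) (by rw [step_apply_ne _ hab.symm, hb])
      (by decide) (by decide)) rfl rfl,
    if_congr (key (step m b) (-1) 0 (fun s _ h1 => step_apply_ne _ h1)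
      (by rw [step_apply_ne _ hab, ha]) (by rw [step_apply_self, hb, h0])
      (by decide) (by decide)) rfl rfl,
    if_congr (key (step (step m a) b) 0 0
      (fun s h1 h2 => (step_apply_ne _ h2).trans (step_apply_ne _ h1))
      (by rw [step_apply_ne _ hab, step_apply_self, ha, h0])
      (by rw [step_apply_self, step_apply_ne _ hab.symm, hb, h0])
      (by decide) (by decide)) rfl rfl,
    if_congr (key m (-1) (-1) (fun _ _ _ => rfl) ha hb (by decide) (by decide)) rfl rfl]
  have h1 : (x a).1 = 0 ∨ (x a).1 = -1 := (Classical.em _).imp_right Vertex.apply_eq_neg_one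
  have h2 : (x b).1 = 0 ∨ (x b).1 = -1 := (Classical.em _).imp_right Vertex.apply_eq_neg_one
  have h3 : (0 : SignType) ≠ -1 := by decide
  rcases h1 with h1 | h1 <;> rcases h2 with h2 | h2 <;> simp [h1, h2, h3, h3.symm]

/-- In the relation of the twisted cube from i to j, the products through the two intermediate
corners are, up to a common sign, the two composites. The remaining products, through the start and
end corners, combine with the differential of `X.q i j` to the differential of the diagonal matrix.
-/
theorem edge_comm_of_neg_of_neg (m : Vertex₂ S) {a b : S} (hab : a ≠ b) (ha : m a = -1)
    (hb : m b = -1) : Homotopic k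
    (comp (k := k) (X.edge (step m a) (step (step m a) b) b) (X.edge m (step m a) a))
      (-comp (k := k) (X.edge (step m b) (step (step m a) b) a) (X.edge m (step m b) b)) := by
  classical
  have hxb : step m a b = -1 := (step_apply_ne _ hab.symm).trans hb
  have hya : step m b a = -1 := (step_apply_ne _ hab).trans ha
  have hdeg : (step (step m a) b).deg = m.deg + 2 := by
    rw [deg_step_of_neg hxb, deg_step_of_neg ha]; ring
  have hmem : (X.ofEntries m (step (step m a) b) (fun i j => sgn k m.deg • X.q i j)) ∈
      gr (k := k) (X.sub m) (X.sub (step (step m a) b)) (-1) := by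
    intro i j
    have h := Submodule.smul_mem _ (sgn k m.deg) (X.q_mem_all i.1 j.1)
    have e : -1 + (i.1.deg - m.deg) - (j.1.deg - (step (step m a) b).deg) =
        i.1.deg - j.1.deg + 1 := by rw [hdeg]; ring
    rw [← e] at h
    exact h
  -- The homotopy consists of the morphisms of `X` from the first to the last corner with sign
  -- (-1)^|m'|; its degree is -1 because the square raises |m'| by two.
  refine ⟨_, Eq.trans ?_ (congrArg (d (k := k)) (Eq.refl
    (X.ofEntries m (step (step m a) b) (fun i j => sgn k m.deg • X.q i j))))⟩
  rw [sub_neg_eq_add, X.edge_of_eq ha, X.edge_of_eq hb, X.edge_of_eq hxb, X.edge_of_eq hya]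
  funext i j
  rw [TwistedComplex.d_apply k hmem]
  refine (congrArg₂ (· + ·) (X.ofEntries_comp_apply _ _ _ _ _ i j)
    (X.ofEntries_comp_apply _ _ _ _ _ i j)).trans ?_
  change _ = sgn k (j.1.deg - (step (step m a) b).deg) • d (k := k) (sgn k m.deg • X.q i.1 j.1) +
    ∑ x : {i : Vertex S // (step (step m a) b).Face i},
      comp (k := k) (sgn k (step (step m a) b).deg • X.q x.1 j.1) (sgn k m.deg • X.q i.1 x.1) -
    sgn k (-1) • ∑ x : {i : Vertex S // m.Face i},
      comp (k := k) (sgn k m.deg • X.q x.1 j.1) (sgn k m.deg • X.q i.1 x.1)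
  have h2 : sgn k 2 = 1 := by
    have := sgn_mul_self k 1
    rwa [← sgn_add] at this
  have hs : sgn k (-1) = -1 := by rw [sgn_neg, sgn_one]
  rw [hdeg, deg_step_of_neg ha, deg_step_of_neg hb, sgn_sub, sgn_add, sgn_add, h2, hs, sgn_one]
  simp only [map_smul, map_neg, LinearMap.smul_apply, smul_smul,
    sgn_mul_self, one_smul, mul_one, mul_neg, neg_smul, neg_neg, sub_neg_eq_add]
  rw [mul_assoc, sgn_mul_self, mul_one, sum_face (step (step m a) b)
      (fun x => comp (k := k) (X.q x j.1) (X.q i.1 x)),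
    sum_face m (fun x => comp (k := k) (X.q x j.1) (X.q i.1 x))]
  have hsum := sum_faces m hab ha hb i.2 j.2 (fun x => comp (k := k) (X.q x j.1) (X.q i.1 x))
    (fun x hx => by
      by_cases h1 : i.1 < x
      · rw [X.q_eq_zero x j.1 fun h2 => hx ⟨h1, h2⟩]; simp
      · rw [X.q_eq_zero i.1 x h1]; simp)
  have hrel := X.rel_all i.1 j.1
  rw [← hsum] at hrel
  have hneg : ∀ (p : Prop) [Decidable p] (z : Hom k (X.obj i.1) (X.obj j.1)),
      (if p then -z else 0) = -(if p then z else 0) := by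
    intro p _ z
    split_ifs
    · rfl
    · exact neg_zero.symm
  simp only [hneg, Finset.sum_neg_distrib]
  have key : ∀ {M : Type v} [AddCommGroup M] (A B D P Q : M), D + (A + B + (P + Q)) = 0 →
      -A + -B = D + P + Q := by
    intro M _ A B D P Q h
    rw [← sub_eq_zero, ← neg_eq_zero, ← h]
    abel
  exact key _ _ _ _ _ hrel

theorem edge_comm (m : Vertex₂ S) {a b : S} (hab : a ≠ b) : ∃ ε : ℤˣ, Homotopic k
    (comp (k := k) (X.edge (step m a) (step (step m a) b) b) (X.edge m (step m a) a))
      ((ε : ℤ) • comp (k := k) (X.edge (step m b) (step (step m a) b) a)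
        (X.edge m (step m b) b)) := by
  by_cases ha : m a = -1
  · by_cases hb : m b = -1
    · exact ⟨-1, by simpa using X.edge_comm_of_neg_of_neg m hab ha hb⟩
    · obtain ⟨ε, h⟩ := X.edge_comm_of_neg_of_ne m hab ha hb
      exact ⟨ε, by rw [h]; exact .refl _⟩
  · by_cases hb : m b = -1
    · obtain ⟨ε, h⟩ := X.edge_comm_of_neg_of_ne m hab.symm hb ha
      refine ⟨ε, ?_⟩
      -- The previous case with a and b exchanged; the sign moves to the other side because its
      -- square is 1.
      rw [step_comm m (a := a), h, smul_smul, ← Units.val_mul, Int.units_mul_self, Units.val_one,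
        one_smul]
      exact .refl _
    · refine ⟨1, ?_⟩
      rw [X.edge_of_ne ha, X.edge_of_ne hb,
        X.edge_of_ne (by rwa [step_apply_ne _ hab.symm] : step m a b ≠ -1),
        X.edge_of_ne (by rwa [step_apply_ne _ hab] : step m b a ≠ -1), Units.val_one, one_smul,
        X.idMap_comm (fun s => step_step_pair m hab s)
          (fun s => by rw [step_comm m]; exact step_step_pair m hab.symm s)]
      exact .refl _

/-- This is the vanishing of two successive arrows of a cone triangle, with homotopies given by
identities of common objects. -/
theorem edge_comp_edge (m : Vertex₂ S) (a : S) : Homotopic k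
    (comp (k := k) (X.edge (step m a) (step (step m a) a) a) (X.edge m (step m a) a)) 0 := by
  classical
  have hx : ∀ s, s ≠ a → step m a s = m s := fun s hs => step_apply_ne _ hs
  have hn : ∀ s, s ≠ a → step (step m a) a s = m s := fun s hs => (step_apply_ne _ hs).trans (hx s hs)
  have hxa : step m a a = next (m a) := step_apply_self _ _
  have hna : step (step m a) a a = next (next (m a)) := by rw [step_apply_self, hxa]
  have n₁ : next (-1) = 0 := by decide
  have n₂ : next 0 = 1 := by decide
  have n₃ : next 1 = -1 := by decide
  have h01 : (0 : SignType) ≠ 1 := by decide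
  have hm1 : (-1 : SignType) ≠ 1 := by decide
  have h0m : (0 : SignType) ≠ -1 := by decide
  have h1m : (1 : SignType) ≠ -1 := by decide
  rcases (by generalize m a = x; revert x; decide : m a = -1 ∨ m a = 0 ∨ m a = 1) with h | h | h
  · rw [h, n₁] at hxa
    rw [h, n₁, n₂] at hna
    -- The inclusion of the objects of Y^l into Y^n, of degree -1. It fails to be closed precisely
    -- by the entries from coordinate -1 to coordinate 0.
    refine ⟨X.idMap m (step (step m a) a), ?_⟩
    rw [sub_zero, X.edge_of_eq h, X.edge_of_ne (by rw [hxa]; exact h0m)]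
    funext i j
    refine (X.idMap_comp_apply _ _ _ _ i j).trans
      (Eq.trans ?_ (X.d_idMap_apply _ _ i j).symm)
    rw [if_pos (Vertex.face_of_eq_of_ne i.2 hn fun h => absurd hna h), deg_step_of_zero hxa,
      deg_step_of_neg h, sgn_add, sgn_one, mul_neg, mul_one, neg_smul]
    by_cases hj : (j.1 a).1 = 0
    · rw [if_pos (Vertex.face_of_eq_of_ne j.2 (fun s hs => (hx s hs).trans (hn s hs).symm)
        fun _ => hj.trans hxa.symm), if_neg, sub_zero]
      intro hjm
      exact h0m (hj.symm.trans ((hjm a (by rw [h]; exact hm1)).trans h))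
    · rw [if_pos (Vertex.face_of_eq_of_ne j.2 (fun s hs => (hn s hs).symm)
        fun _ => (Vertex.apply_eq_neg_one hj).trans h.symm), if_neg, sub_self, smul_zero, neg_zero]
      intro hjx
      exact hj ((hjx a (by rw [hxa]; exact h01)).trans hxa)
  · rw [h, n₂] at hxa
    rw [h, n₂, n₃] at hna
    rw [X.edge_of_ne (m := m) (by rw [h]; exact h0m),
      X.edge_of_ne (m := step m a) (by rw [hxa]; exact h1m)]
    -- Y^m and Y^l have no object in common, so this composite is zero without a homotopy.
    have h0 : comp (k := k) (X.idMap (step m a) (step (step m a) a)) (X.idMap m (step m a)) = 0 := by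
      funext i j
      refine (X.idMap_comp_apply _ _ _ _ i j).trans ?_
      rw [X.idEntry_ne, ite_self]
      · rfl
      · intro hij
        have h1 := (i.2 a (by rw [h]; exact h01)).trans h
        have h2 := (j.2 a (by rw [hna]; exact hm1)).trans hna
        rw [hij, h2] at h1
        exact h0m h1.symm
    rw [h0]
    exact .refl _
  · rw [h, n₃] at hxa
    rw [h, n₃, n₁] at hna
    -- The projection of Y^n onto the objects of Y^m has degree 0, one less than the composite,
    -- which contains the wrap-around arrow.
    refine ⟨-X.idMap m (step (step m a) a), ?_⟩
    rw [sub_zero, X.edge_of_ne (m := m) (by rw [h]; exact h1m), X.edge_of_eq hxa, map_neg]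
    funext i j
    refine (X.comp_idMap_apply _ _ _ _ i j).trans
      (Eq.trans ?_ (congrArg Neg.neg (X.d_idMap_apply _ _ i j)).symm)
    rw [if_pos (Vertex.face_of_eq_of_ne j.2 (fun s hs => (hn s hs).symm) fun h' => absurd h h'),
      deg_step_of_neg hxa, sgn_add, sgn_one, mul_neg, mul_one, neg_smul]
    by_cases hi : (i.1 a).1 = 0
    · rw [if_pos (Vertex.face_of_eq_of_ne i.2 hn fun _ => hi.trans hna.symm), if_neg, sub_self,
        smul_zero, neg_zero]
      · exact neg_zero.symm
      · intro hix
        exact h0m (hi.symm.trans ((hix a (by rw [hxa]; exact hm1)).trans hxa))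
    · rw [if_pos (Vertex.face_of_eq_of_ne i.2 hx
        fun _ => (Vertex.apply_eq_neg_one hi).trans hxa.symm), if_neg, zero_sub, smul_neg, neg_neg]
      · rfl
      · intro hin
        exact hi ((hin a (by rw [hna]; exact h01)).trans hna)

end TwistedCube
end DGCategory

/-! ### Compositions along paths -/

namespace DGCategory
namespace SideTwoDiagram
variable {k : Type w} [CommRing k] {C : Type u} [DGCategory.{v} k C] {S : Type}

/-- `f` is the composition of the morphisms of `Z` along the path from `m` to `n` which moves along
the rows in the directions `w`. -/
def IsPath (Z : SideTwoDiagram k C S) :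
    List S → ∀ m n : Vertex₂ S, Hom k (Z.obj m) (Z.obj n) → Prop
  | [], m, n, f => ∃ h : m = n, f = ofEq k (congrArg Z.obj h)
  | a :: w, m, n, f => ∃ g : Hom k (Z.obj (step m a)) (Z.obj n), IsPath Z w (step m a) n g ∧
      f = comp (k := k) g (Z.r m (step m a))

variable {Z : SideTwoDiagram k C S}

/-- The end n is a free variable, so the comparison of ends enters once and no further transport of
morphisms is needed when the steps are rearranged. -/
theorem isPath_pathHom (w : List S) : ∀ (m : Vertex₂ S) {n : Vertex₂ S} (h : pathEnd m w = n),
    Z.IsPath w m n (comp (k := k) (ofEq k (congrArg Z.obj h)) (pathHom Z m w)) := by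
  induction w with
  | nil =>
    rintro m n rfl
    exact ⟨rfl, id_comp _⟩
  | cons a w ih =>
    intro m n h
    exact ⟨_, ih (step m a) h, (assoc _ _ _).symm⟩

theorem isPath_pathHom_self (w : List S) (m : Vertex₂ S) :
    Z.IsPath w m (pathEnd m w) (pathHom Z m w) := by
  have h := isPath_pathHom (Z := Z) w m rfl
  rwa [show ofEq k (congrArg Z.obj (rfl : pathEnd m w = _)) = id (k := k) _ from rfl, id_comp] at h

theorem IsPath.unique {w : List S} : ∀ {m n : Vertex₂ S} {f g : Hom k (Z.obj m) (Z.obj n)},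
    Z.IsPath w m n f → Z.IsPath w m n g → f = g := by
  induction w with
  | nil =>
    rintro m n f g ⟨_, rfl⟩ ⟨_, rfl⟩
    rfl
  | cons a w ih =>
    rintro m n f g ⟨f, hf, rfl⟩ ⟨g, hg, rfl⟩
    rw [ih hf hg]

theorem IsPath.closed (hc : ∀ m a, ∃ p, IsClosedOfDeg k p (Z.r m (step m a))) {w : List S} :
    ∀ {m n : Vertex₂ S} {f : Hom k (Z.obj m) (Z.obj n)}, Z.IsPath w m n f →
      ∃ p, IsClosedOfDeg k p f := by
  induction w with
  | nil =>
    rintro m n f ⟨rfl, rfl⟩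
    exact ⟨0, isClosedOfDeg_id _⟩
  | cons a w ih =>
    rintro m n f ⟨f, hf, rfl⟩
    obtain ⟨p, hp⟩ := ih hf
    obtain ⟨q, hq⟩ := hc m a
    exact ⟨_, hp.comp hq⟩

/-- The squares of `Z` commute up to signs and homotopy. -/
def SquaresCommute (Z : SideTwoDiagram k C S) : Prop :=
  ∀ (m : Vertex₂ S) (a b : S), a ≠ b → ∃ ε : ℤˣ, Homotopic k
    (comp (k := k) (Z.r (step m a) (step (step m a) b)) (Z.r m (step m a)))
    ((ε : ℤ) • comp (k := k) (Z.r (step m b) (step (step m a) b)) (Z.r m (step m b)))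

/-- With the corner x as a variable, the equality of the two orders of stepping can be substituted
instead of transporting `g`. -/
theorem isPath_swap {a b : S} {w : List S} {m x n : Vertex₂ S}
    {g : Hom k (Z.obj x) (Z.obj n)} (hx : x = step (step m b) a) (hg : Z.IsPath w x n g) :
    Z.IsPath (b :: a :: w) m n (comp (k := k) g
      (comp (k := k) (Z.r (step m b) x) (Z.r m (step m b)))) := by
  subst hx
  exact ⟨_, ⟨g, hg, rfl⟩, (assoc _ _ _).symm⟩

/-- A permutation is a product of adjacent transpositions, and each of these is a square of `Z`;
closedness of the rest of the path carries the homotopy along. -/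
theorem IsPath.perm (hc : ∀ m a, ∃ p, IsClosedOfDeg k p (Z.r m (step m a)))
    (hZ : Z.SquaresCommute) {w w' : List S} (hw : w.Perm w') :
    ∀ {m n : Vertex₂ S} {f : Hom k (Z.obj m) (Z.obj n)}, Z.IsPath w m n f →
      ∃ g, Z.IsPath w' m n g ∧ ∃ ε : ℤˣ, Homotopic k f ((ε : ℤ) • g) := by
  induction hw with
  | nil =>
    intro m n f hf
    exact ⟨f, hf, 1, by rw [Units.val_one, one_smul]; exact .refl _⟩
  | cons a _ ih =>
    rintro m n f ⟨f, hf, rfl⟩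
    obtain ⟨g, hg, ε, hε⟩ := ih hf
    refine ⟨_, ⟨g, hg, rfl⟩, ε, ?_⟩
    obtain ⟨p, hp⟩ := hc m a
    have := hε.comp_right hp.2
    rwa [map_zsmul, LinearMap.smul_apply] at this
  | swap b a w =>
    rintro m n f ⟨_, ⟨g, hg, rfl⟩, rfl⟩
    by_cases hab : a = b
    · subst hab
      exact ⟨_, ⟨_, ⟨g, hg, rfl⟩, rfl⟩, 1, by rw [Units.val_one, one_smul]; exact .refl _⟩
    obtain ⟨ε, hε⟩ := hZ m a b hab
    refine ⟨_, isPath_swap (step_comm m) hg, ε, ?_⟩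
    obtain ⟨p, hp⟩ := hg.closed hc
    have h := hε.comp_left hp
    rwa [map_zsmul, ← assoc] at h
  | trans _ _ ih₁ ih₂ =>
    intro m n f hf
    obtain ⟨g, hg, ε, hε⟩ := ih₁ hf
    obtain ⟨h, hh, δ, hδ⟩ := ih₂ hg
    refine ⟨h, hh, ε * δ, hε.trans ?_⟩
    rw [Units.val_mul, mul_smul]
    exact hδ.zsmul _

theorem IsPath.homotopic_zero (hc : ∀ m a, ∃ p, IsClosedOfDeg k p (Z.r m (step m a)))
    (hZ : Z.SquaresCommute)
    (h0 : ∀ m a, Homotopic k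
      (comp (k := k) (Z.r (step m a) (step (step m a) a)) (Z.r m (step m a))) 0)
    [DecidableEq S] {w : List S} {a : S} (hw : 2 ≤ w.count a) {m n : Vertex₂ S}
    {f : Hom k (Z.obj m) (Z.obj n)} (hf : Z.IsPath w m n f) : Homotopic k f 0 := by
  -- Both occurrences of the direction are moved to the front, where they form two successive arrows
  -- of one row.
  obtain ⟨w', hw'⟩ : ∃ w', w.Perm (a :: a :: w') := by
    exact (List.replicate_sublist_iff.2 hw).exists_perm_append
  obtain ⟨_, ⟨_, ⟨g, hg, rfl⟩, rfl⟩, ε, hε⟩ := hf.perm hc hZ hw'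
  refine hε.trans ?_
  obtain ⟨p, hp⟩ := hg.closed hc
  have h := ((h0 m a).comp_left hp).zsmul (ε : ℤ)
  rwa [map_zero, smul_zero, ← assoc] at h

theorem cast_next (x : SignType) : ((next x : SignType) : ℤ) = x + 1 - 3 * if x = 1 then 1 else 0 := by
  revert x; decide

/-- A step adds 1 modulo 3 to its coordinate, the wrap-around from 1 to -1 included. The ends thus
determine the multiplicity of each direction modulo 3. -/
theorem cast_pathEnd_modEq [DecidableEq S] (s : S) (w : List S) : ∀ m : Vertex₂ S,
    ((pathEnd m w s : SignType) : ℤ) ≡ m s + w.count s [ZMOD 3] := by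
  induction w with
  | nil => intro m; simp [pathEnd]
  | cons a w ih =>
    intro m
    refine (ih (step m a)).trans ?_
    by_cases h : s = a
    · subst h
      rw [step_apply_self, cast_next, List.count_cons_self, Int.modEq_iff_dvd]
      exact ⟨if m s = 1 then 1 else 0, by push_cast; ring⟩
    · rw [step_apply_ne _ h, List.count_cons_of_ne (Ne.symm h)]

/-- An ordinary step raises the sum of the coordinates by 1, a wrap-around changes it by 1 - 3. The
ends and the degree thus determine the length of a path. -/
theorem sum_cast_pathEnd [Fintype S] (w : List S) : ∀ m : Vertex₂ S,
    ∑ s, ((pathEnd m w s : SignType) : ℤ) = ∑ s, (m s : ℤ) + w.length - 3 * pathDeg m w := by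
  classical
  induction w with
  | nil => intro m; simp [pathEnd, pathDeg]
  | cons a w ih =>
    intro m
    have h1 : ∑ s, ((step m a s : SignType) : ℤ) =
        ∑ s, (m s : ℤ) + (1 - 3 * if m a = 1 then 1 else 0) := by
      rw [← sub_eq_iff_eq_add', ← Finset.sum_sub_distrib, Finset.sum_eq_single a]
      · rw [step_apply_self, cast_next]; ring
      · intro s _ hs
        rw [step_apply_ne _ hs, sub_self]
      · simp
    change ∑ s, ((pathEnd (step m a) w s : SignType) : ℤ) =
      _ + ((w.length + 1 : ℕ) : ℤ) - 3 * (pathDeg (step m a) w + if m a = 1 then 1 else 0)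
    rw [ih, h1]
    push_cast
    ring

/-- A multiplicity 0 or 1 is the least natural number in its class modulo 3, so the multiplicities
of `w` are at most those of `w'`, and equality of lengths does the rest. -/
theorem perm_of_count_le_one [DecidableEq S] {w w' : List S} (h : ∀ s, w.count s ≤ 1)
    (hl : w.length = w'.length) (hc : ∀ s, (w.count s : ℤ) ≡ w'.count s [ZMOD 3]) : w.Perm w' := by
  refine List.Subperm.perm_of_length_le (List.subperm_ext_iff.2 fun s _ => ?_) hl.ge
  have h1 := h s
  have h2 := hc s
  rw [Int.modEq_iff_dvd] at h2
  omega

theorem commutesUpToSign_of_squaresCommute [Fintype S]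
    (hc : ∀ m a, ∃ p, IsClosedOfDeg k p (Z.r m (step m a))) (hZ : Z.SquaresCommute)
    (h0 : ∀ m a, Homotopic k
      (comp (k := k) (Z.r (step m a) (step (step m a) a)) (Z.r m (step m a))) 0) :
    Z.CommutesUpToSign := by
  classical
  intro m w w' h hdeg
  have hp := isPath_pathHom (Z := Z) w m h
  have hp' := isPath_pathHom_self (Z := Z) w' m
  have hl : w.length = w'.length := by
    have h1 := sum_cast_pathEnd w m
    have h2 := sum_cast_pathEnd w' m
    rw [h] at h1
    omega
  have hcount : ∀ s, (w.count s : ℤ) ≡ w'.count s [ZMOD 3] := by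
    intro s
    have h1 := cast_pathEnd_modEq s w m
    have h2 := cast_pathEnd_modEq s w' m
    rw [h] at h1
    exact Int.ModEq.add_left_cancel' _ (h1.symm.trans h2)
  by_cases hw : ∀ s, w.count s ≤ 1
  · obtain ⟨g, hg, ε, hε⟩ := hp.perm hc hZ (perm_of_count_le_one hw hl hcount)
    rw [hg.unique hp'] at hε
    exact ⟨ε, hε⟩
  by_cases hw' : ∀ s, w'.count s ≤ 1
  · obtain ⟨g, hg, ε, hε⟩ :=
      hp.perm hc hZ (perm_of_count_le_one hw' hl.symm fun s => (hcount s).symm).symm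
    rw [hg.unique hp'] at hε
    exact ⟨ε, hε⟩
  push Not at hw hw'
  obtain ⟨a, ha⟩ := hw
  obtain ⟨b, hb⟩ := hw'
  -- Here both paths repeat a direction and are null-homotopic, so any sign would do.
  refine ⟨1, ?_⟩
  rw [Units.val_one, one_smul]
  exact (hp.homotopic_zero hc hZ h0 ha).trans (hp'.homotopic_zero hc hZ h0 hb).symm

section completion
variable [Fintype S] {L : Level} {X : TwistedCube k C S}
  {θ : ∀ m, Hom k (TwistedComplex.single k (Z.obj m)) (X.sub m)}

open TwistedComplex

/-- Under `θ`, two successive arrows of `Z` become two successive edges; homotopies between edges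
then pass to `Z` by cancelling the equivalence at the end. -/
theorem IsCompletion.comp_step (hZ : Z.IsCompletion L X θ) {m x n : Vertex₂ S} {a b : S}
    (hx : x = step m a) (hn : n = step x b) : Homotopic k
    (comp (k := k) (θ n) (singleMap k (comp (k := k) (Z.r x n) (Z.r m x))))
    (comp (k := k) (comp (k := k) (X.edge x n b) (X.edge m x a)) (θ m)) := by
  obtain ⟨-, h, -⟩ := isCompletion_iff.1 hZ
  have h1 := Same.homotopic (h x n b hn).2
  have h2 := Same.homotopic (h m x a hx).2
  have h3 := h1.comp_right (isClosedOfDeg_singleMap.2 (h m x a hx).1).2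
  have h4 := h2.comp_left (X.edge_closed hn)
  rw [assoc, assoc] at h3
  rw [singleMap_comp, assoc]
  exact h3.trans h4

theorem IsCompletion.closed (hZ : Z.IsCompletion L X θ) {m n : Vertex₂ S} {a : S}
    (h : n = step m a) : IsClosedOfDeg k (if m a = 1 then 1 else 0) (Z.r m n) :=
  ((isCompletion_iff.1 hZ).2.1 m n a h).1

theorem IsCompletion.squaresCommute (hZ : Z.IsCompletion L X θ) : Z.SquaresCommute := by
  intro m a b hab
  obtain ⟨ε, hε⟩ := X.edge_comm m hab
  refine ⟨ε, ?_⟩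
  have h1 := hZ.comp_step (m := m) (a := a) (b := b) rfl rfl
  have h2 := (hZ.comp_step (m := m) (a := b) (b := a) rfl (step_comm m)).zsmul (ε : ℤ)
  have h3 := hε.comp_right (hZ.equivalence m).1.2
  rw [map_zsmul, LinearMap.smul_apply] at h3
  rw [← map_zsmul] at h2
  have h4 := (h1.trans h3).trans h2.symm
  have c1 := (hZ.closed (m := step m a) (a := b) rfl).comp (hZ.closed (m := m) (a := a) rfl)
  have c2 := ((hZ.closed (m := step m b) (a := a) (step_comm m)).comp
    (hZ.closed (m := m) (a := b) rfl)).zsmul (ε : ℤ)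
  rw [← isClosedOfDeg_singleMap] at c1 c2
  exact same_singleMap.1 ((hZ.equivalence _).homotopy.cancel_left (L := .homotopy) c1 c2 h4)

theorem IsCompletion.comp_homotopic_zero (hZ : Z.IsCompletion L X θ) (m : Vertex₂ S) (a : S) :
    Homotopic k (comp (k := k) (Z.r (step m a) (step (step m a) a)) (Z.r m (step m a))) 0 := by
  have h1 := hZ.comp_step (m := m) (a := a) (b := a) rfl rfl
  have h3 := (X.edge_comp_edge m a).comp_right (hZ.equivalence m).1.2
  rw [map_zero, LinearMap.zero_apply, ← map_zero (comp (k := k) (θ (step (step m a) a)))] at h3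
  have c1 := (hZ.closed (m := step m a) (a := a) rfl).comp (hZ.closed (m := m) (a := a) rfl)
  rw [← isClosedOfDeg_singleMap] at c1
  exact same_singleMap.1 ((hZ.equivalence _).homotopy.cancel_left (L := .homotopy) (q := 0)
    (g := singleMap k 0) c1 ⟨Submodule.zero_mem _, map_zero _⟩ (h1.trans h3))

theorem IsCompletion.commutesUpToSign (hZ : Z.IsCompletion L X θ) : Z.CommutesUpToSign :=
  commutesUpToSign_of_squaresCommute (fun m a => ⟨_, hZ.closed (m := m) (a := a) rfl⟩)
    hZ.squaresCommute hZ.comp_homotopic_zero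

end completion

end SideTwoDiagram
end DGCategory

/-! ### Regrouping a twisted complex into blocks -/

namespace DGCategory

/-- A family of twisted complexes whose summands are among those of `E`. -/
structure Subdivision {k : Type w} [CommRing k] {C : Type u} [DGCategory.{v} k C]
    (E : TwistedComplex k C) where
  ι : Type
  [fintype : Fintype ι]
  fib : ι → Type
  [fintype_fib : ∀ κ, Fintype (fib κ)]
  fibDeg : ∀ κ, fib κ → ℤ
  pt : ∀ κ, fib κ → E.ι
  fibα : ∀ κ (i j : fib κ), Hom k (E.obj (pt κ i)) (E.obj (pt κ j))
  fibα_mem : ∀ κ (i j : fib κ), fibα κ i j ∈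
    gr (k := k) (E.obj (pt κ i)) (E.obj (pt κ j)) (fibDeg κ i - fibDeg κ j + 1)
  fib_maurerCartan : ∀ κ (i j : fib κ), sgn k (fibDeg κ j) • d (k := k) (fibα κ i j) +
    ∑ m, comp (k := k) (fibα κ m j) (fibα κ i m) = 0

attribute [instance] Subdivision.fintype Subdivision.fintype_fib

/-- The parts of a subdivision as twisted complexes. -/
def Subdivision.part {k : Type w} [CommRing k] {C : Type u} [DGCategory.{v} k C]
    {E : TwistedComplex k C} (P : Subdivision E) (κ : P.ι) : TwistedComplex k C where
  ι := P.fib κ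
  deg := P.fibDeg κ
  obj i := E.obj (P.pt κ i)
  α := P.fibα κ
  α_mem := P.fibα_mem κ
  maurerCartan := P.fib_maurerCartan κ

/-- A presentation of `E` as the total complex of a twisted complex of twisted complexes. -/
structure Splitting {k : Type w} [CommRing k] {C : Type u} [DGCategory.{v} k C]
    (E : TwistedComplex k C) extends Subdivision E where
  deg : ι → ℤ
  α : ∀ κ μ, Hom k (toSubdivision.part κ) (toSubdivision.part μ)
  α_mem : ∀ κ μ, α κ μ ∈
    gr (k := k) (toSubdivision.part κ) (toSubdivision.part μ) (deg κ - deg μ + 1)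
  maurerCartan : ∀ κ μ, sgn k (deg μ) • d (k := k) (α κ μ) +
    ∑ m, comp (k := k) (α m μ) (α κ m) = 0
  bijective : Function.Bijective fun x : (κ : ι) × fib κ => pt x.1 x.2
  deg_eq : ∀ κ (i : fib κ), E.deg (pt κ i) = deg κ + fibDeg κ i
  α_self : ∀ κ, α κ κ = 0
  α_eq_fib : ∀ κ (i j : fib κ), E.α (pt κ i) (pt κ j) = sgn k (deg κ) • fibα κ i j
  α_eq_of_ne : ∀ κ μ, κ ≠ μ → ∀ (i : fib κ) (j : fib μ), E.α (pt κ i) (pt μ j) = α κ μ i j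

theorem Fam.mat_sum_apply {k : Type w} [CommRing k] {C : Type u} [DGCategory.{v} k C]
    {E F : Fam C} {I : Type*} [Fintype I] (A : I → Fam.Mat k E F) (i : E.ι) (j : F.ι) :
    (∑ ν, A ν) i j = ∑ ν, A ν i j := by
  rw [Finset.sum_apply, Finset.sum_apply]

theorem Fam.mat_combination_apply {k : Type w} [CommRing k] {C : Type u} [DGCategory.{v} k C]
    {E F : Fam C} {I J : Type*} [Fintype I] [Fintype J] (c s : k) {A : Fam.Mat k E F}
    (B : I → Fam.Mat k E F) (D : J → Fam.Mat k E F) {i : E.ι} {j : F.ι}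
    {a : Hom k (E.obj i) (F.obj j)} (ha : A i j = a) :
    (c • A + ∑ ν, B ν - s • ∑ ν, D ν) i j = c • a + ∑ ν, B ν i j - s • ∑ ν, D ν i j := by
  rw [Pi.sub_apply, Pi.sub_apply, Pi.add_apply, Pi.add_apply, Pi.smul_apply, Pi.smul_apply,
    Pi.smul_apply, Pi.smul_apply, mat_sum_apply, mat_sum_apply, ha]

namespace Splitting
variable {k : Type w} [CommRing k] {C : Type u} [DGCategory.{v} k C]
  {E F G : TwistedComplex k C} (P : Splitting E) (Q : Splitting F) (R : Splitting G)

/-- The twisted complex of twisted complexes given by a splitting. -/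
def total : TwistedComplex k (TwistedComplex k C) where
  ι := P.ι
  deg := P.deg
  obj := P.part
  α := P.α
  α_mem := P.α_mem
  maurerCartan := P.maurerCartan

/-- The block form of a matrix. -/
def block (f : Hom k E F) : Hom k P.total Q.total :=
  fun κ μ i j => f (P.pt κ i) (Q.pt μ j)

theorem sum_pt {A : Type*} [AddCommMonoid A] (g : E.ι → A) :
    ∑ x, g x = ∑ κ, ∑ i, g (P.pt κ i) := by
  rw [← P.bijective.sum_comp g, Fintype.sum_sigma]

theorem block_add (f g : Hom k E F) : P.block Q (f + g) = P.block Q f + P.block Q g := rfl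

theorem block_sub (f g : Hom k E F) : P.block Q (f - g) = P.block Q f - P.block Q g := rfl

theorem block_mem {p : ℤ} {f : Hom k E F} (hf : f ∈ gr (k := k) E F p) :
    P.block Q f ∈ gr (k := k) P.total Q.total p := by
  intro (κ : P.ι) (μ : Q.ι) (i : P.fib κ) (j : Q.fib μ)
  have h : f (P.pt κ i) (Q.pt μ j) ∈ gr (k := k) (E.obj (P.pt κ i)) (F.obj (Q.pt μ j))
      (p + E.deg (P.pt κ i) - F.deg (Q.pt μ j)) := hf (P.pt κ i) (Q.pt μ j)
  have e : p + E.deg (P.pt κ i) - F.deg (Q.pt μ j) =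
      p + P.deg κ - Q.deg μ + P.fibDeg κ i - Q.fibDeg μ j := by
    rw [P.deg_eq, Q.deg_eq]; ring
  rw [e] at h
  exact h

theorem block_comp (g : Hom k F G) (f : Hom k E F) :
    P.block R (comp (k := k) g f) = comp (k := k) (Q.block R g) (P.block Q f) := by
  refine funext fun (κ : P.ι) => funext fun (μ : R.ι) => funext fun (i : P.fib κ) =>
    funext fun (j : R.fib μ) => ?_
  refine (Q.sum_pt fun x => comp (k := k) (g x (R.pt μ j)) (f (P.pt κ i) x)).trans ?_
  exact (Fam.mat_sum_apply (k := k) (I := Q.ι) (E := (P.part κ).toFam) (F := (R.part μ).toFam)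
    (fun ν => comp (k := k) (X := P.part κ) (Y := Q.part ν) (Z := R.part μ) (Q.block R g ν μ)
      (P.block Q f κ ν)) i j).symm

theorem block_id : P.block P (id (k := k) E) = id (k := k) P.total := by
  refine funext fun (κ : P.ι) => funext fun (μ : P.ι) => funext fun (i : P.fib κ) =>
    funext fun (j : P.fib μ) => ?_
  change Fam.matId k E.toFam (P.pt κ i) (P.pt μ j) =
    (Fam.matId k P.total.toFam κ μ : Fam.Mat k (P.part κ).toFam (P.part μ).toFam) i j
  by_cases h : κ = μ
  · subst h
    refine Eq.trans ?_ (congrFun (congrFun (Fam.matId_self k P.total.toFam κ) i) j).symm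
    change _ = Fam.matId k (P.part κ).toFam i j
    by_cases h : i = j
    · subst h
      exact (Fam.matId_self k E.toFam _).trans (Fam.matId_self k (P.part κ).toFam i).symm
    · refine (Fam.matId_ne k E.toFam fun h' => h ?_).trans
        (Fam.matId_ne k (P.part κ).toFam h).symm
      have := P.bijective.1 (a₁ := ⟨κ, i⟩) (a₂ := ⟨κ, j⟩) h'
      simpa using this
  · refine (Fam.matId_ne k E.toFam fun h' => h ?_).trans
      (congrFun (congrFun (Fam.matId_ne k P.total.toFam h) i) j).symm
    have := P.bijective.1 (a₁ := ⟨κ, i⟩) (a₂ := ⟨μ, j⟩) h'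
    exact congrArg Sigma.fst this

/-- The entries of the outer twisted maps of a splitting. -/
def entry (κ μ : P.ι) (i : P.fib κ) (j : P.fib μ) :
    Hom k (E.obj (P.pt κ i)) (E.obj (P.pt μ j)) := P.α κ μ i j

theorem entry_self (κ : P.ι) (i j : P.fib κ) : P.entry κ κ i j = 0 :=
  congrFun (congrFun (P.α_self κ) i) j

theorem α_eq_entry (κ μ : P.ι) (h : κ ≠ μ) (i : P.fib κ) (j : P.fib μ) :
    E.α (P.pt κ i) (P.pt μ j) = P.entry κ μ i j := P.α_eq_of_ne κ μ h i j

/-- The twisted maps ending in block μ are the inner ones of this block, up to the sign of its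
position, and the outer ones. Since the diagonal outer maps are zero, the outer sum may run over all
blocks. -/
theorem sum_α_comp {A : C} (μ : P.ι) (j : P.fib μ) (g : ∀ x, Hom k A (E.obj x)) :
    ∑ x, comp (k := k) (E.α x (P.pt μ j)) (g x) =
      sgn k (P.deg μ) • ∑ i, comp (k := k) (P.fibα μ i j) (g (P.pt μ i)) +
        ∑ ν, ∑ i, comp (k := k) (P.entry ν μ i j) (g (P.pt ν i)) := by
  classical
  rw [P.sum_pt, ← Finset.add_sum_erase _ _ (Finset.mem_univ μ),
    ← Finset.add_sum_erase _ (fun ν => ∑ i, comp (k := k) (P.entry ν μ i j) (g (P.pt ν i)))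
      (Finset.mem_univ μ)]
  have h0 : ∑ i, comp (k := k) (P.entry μ μ i j) (g (P.pt μ i)) = 0 := by
    refine Finset.sum_eq_zero fun i _ => ?_
    rw [P.entry_self]
    simp
  rw [h0, zero_add]
  congr 1
  · rw [Finset.smul_sum]
    refine Finset.sum_congr rfl fun i _ => ?_
    rw [P.α_eq_fib, map_smul, LinearMap.smul_apply]
  · refine Finset.sum_congr rfl fun ν hν => Finset.sum_congr rfl fun i _ => ?_
    rw [P.α_eq_entry ν μ (Finset.ne_of_mem_erase hν)]

theorem sum_comp_α {A : C} (κ : P.ι) (i : P.fib κ) (g : ∀ x, Hom k (E.obj x) A) :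
    ∑ x, comp (k := k) (g x) (E.α (P.pt κ i) x) =
      sgn k (P.deg κ) • ∑ j, comp (k := k) (g (P.pt κ j)) (P.fibα κ i j) +
        ∑ ν, ∑ j, comp (k := k) (g (P.pt ν j)) (P.entry κ ν i j) := by
  classical
  rw [P.sum_pt, ← Finset.add_sum_erase _ _ (Finset.mem_univ κ),
    ← Finset.add_sum_erase _ (fun ν => ∑ j, comp (k := k) (g (P.pt ν j)) (P.entry κ ν i j))
      (Finset.mem_univ κ)]
  have h0 : ∑ j, comp (k := k) (g (P.pt κ j)) (P.entry κ κ i j) = 0 := by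
    refine Finset.sum_eq_zero fun j _ => ?_
    rw [P.entry_self]
    simp
  rw [h0, zero_add]
  congr 1
  · rw [Finset.smul_sum]
    refine Finset.sum_congr rfl fun j _ => ?_
    rw [P.α_eq_fib, map_smul]
  · refine Finset.sum_congr rfl fun ν hν => Finset.sum_congr rfl fun j _ => ?_
    rw [P.α_eq_entry κ ν (Finset.ne_of_mem_erase hν).symm]

/-- Positions add, so the signs of the outer and inner differentials multiply to those of the total
differential, and the commutators with inner and outer twisted maps add up to the commutator with
the full twisted map. -/
theorem d_block (f : Hom k E F) :
    d (k := k) (P.block Q f) = P.block Q (d (k := k) f) := by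
  induction f using hom_induction (k := k) with
  | add f g hf hg => rw [block_add, map_add, hf, hg, map_add, block_add]
  | hom p f hf =>
    have hb := P.block_mem Q hf
    refine funext fun (κ : P.ι) => funext fun (μ : Q.ι) => ?_
    refine (TwistedComplex.d_apply k hb κ μ).trans ?_
    have hbm : P.block Q f κ μ ∈ gr (k := k) (P.part κ) (Q.part μ) (p + P.deg κ - Q.deg μ) := hb κ μ
    refine funext fun (i : P.fib κ) => funext fun (j : Q.fib μ) => ?_
    refine (Fam.mat_combination_apply (k := k) (I := Q.ι) (J := P.ι) (E := (P.part κ).toFam)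
      (F := (Q.part μ).toFam) _ _ _ _ (i := i) (j := j) (TwistedComplex.d_apply k hbm i j)).trans ?_
    refine Eq.trans ?_ (TwistedComplex.d_apply k hf (P.pt κ i) (Q.pt μ j)).symm
    change sgn k (Q.deg μ) • (sgn k (Q.fibDeg μ j) • d (k := k) (f (P.pt κ i) (Q.pt μ j)) +
        ∑ x, comp (k := k) (Q.fibα μ x j) (f (P.pt κ i) (Q.pt μ x)) -
        sgn k (p + P.deg κ - Q.deg μ) •
          ∑ x, comp (k := k) (f (P.pt κ x) (Q.pt μ j)) (P.fibα κ i x)) +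
      ∑ ν, ∑ x, comp (k := k) (Q.entry ν μ x j) (f (P.pt κ i) (Q.pt ν x)) -
      sgn k p • ∑ ν, ∑ x, comp (k := k) (f (P.pt ν x) (Q.pt μ j)) (P.entry κ ν i x) = _
    rw [Q.sum_α_comp μ j (fun x => f (P.pt κ i) x), P.sum_comp_α κ i (fun x => f x (Q.pt μ j)),
      Q.deg_eq, sgn_sub, sgn_add, sgn_add, smul_sub, smul_add, smul_add, smul_smul, smul_smul,
      smul_smul]
    -- The entry of block (κ, μ) has degree p + deg κ - deg μ. The outer sign cancels deg μ and
    -- leaves the sign that relates the inner twisted maps of block κ to the full ones.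
    have e : sgn k (Q.deg μ) * (sgn k p * sgn k (P.deg κ) * sgn k (Q.deg μ)) =
        sgn k p * sgn k (P.deg κ) := by
      linear_combination sgn k p * sgn k (P.deg κ) * sgn_mul_self k (Q.deg μ)
    rw [e]
    abel

theorem isClosedOfDeg_block {p : ℤ} {f : Hom k E F} (hf : IsClosedOfDeg k p f) :
    IsClosedOfDeg k p (P.block Q f) :=
  ⟨P.block_mem Q hf.1, by rw [d_block, hf.2]; rfl⟩

theorem same_block {L : Level} {f g : Hom k E F} (h : Same k L f g) :
    Same k L (P.block Q f) (P.block Q g) := by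
  cases L
  · exact congrArg _ h
  · obtain ⟨a, ha⟩ := h
    exact ⟨P.block Q a, by rw [d_block, ← ha, block_sub]⟩

theorem isEquivalence_block {L : Level} {f : Hom k E F} (h : IsEquivalence k L f) :
    IsEquivalence k L (P.block Q f) := by
  obtain ⟨hf, g, hg, h1, h2⟩ := h
  refine ⟨P.isClosedOfDeg_block Q hf, Q.block P g, Q.isClosedOfDeg_block P hg, ?_, ?_⟩
  · rw [← block_comp, ← block_id]
    exact P.same_block P h1
  · rw [← block_comp, ← block_id]
    exact Q.same_block Q h2

end Splitting
end DGCategory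

/-! ### Recursivity -/

namespace DGCategory

namespace TwistedCube

theorem extend_apply_of_mem {S : Type} {K : Finset S} (m : Vertex₂ K) (s : K) :
    Vertex₂.extend K m s.1 = m s := by
  simp [Vertex₂.extend]

theorem extend_apply_of_notMem {S : Type} {K : Finset S} (m : Vertex₂ K) {s : S} (hs : s ∉ K) :
    Vertex₂.extend K m s = 1 := by
  simp [Vertex₂.extend, hs]

open SideTwoDiagram in
theorem step_extend {S : Type} {K : Finset S} (m : Vertex₂ K) (a : K) :
    step (Vertex₂.extend K m) a.1 = Vertex₂.extend K (step m a) := by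
  funext s
  by_cases hs : s ∈ K
  · by_cases hsa : s = a.1
    · subst hsa
      rw [step_apply_self, extend_apply_of_mem, extend_apply_of_mem, step_apply_self]
    · rw [step_apply_ne _ hsa, extend_apply_of_mem m ⟨s, hs⟩, extend_apply_of_mem _ ⟨s, hs⟩,
        step_apply_ne _ fun h => hsa (congrArg Subtype.val h)]
  · have hsa : s ≠ a.1 := fun h => hs (h ▸ a.2)
    rw [step_apply_ne _ hsa, extend_apply_of_notMem _ hs, extend_apply_of_notMem _ hs]

theorem extend_injective {S : Type} (K : Finset S) : Function.Injective (Vertex₂.extend K) := by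
  intro m n h
  funext s
  rw [← extend_apply_of_mem m, h, extend_apply_of_mem]

theorem face_restrict {S : Type} {K : Finset S} {m : Vertex₂ K} {i : Vertex S}
    (hi : (Vertex₂.extend K m).Face i) : m.Face fun s : K => i s.1 := by
  intro s hs
  have h := hi s.1 (by rwa [extend_apply_of_mem])
  rwa [extend_apply_of_mem] at h


variable {k : Type w} [CommRing k] {C : Type u} [DGCategory.{v} k C] {S : Type} [Fintype S]

theorem deg_extend_vertex (K : Finset S) (m : Vertex₂ K) : (Vertex₂.extend K m).deg = m.deg := by
  classical
  simp only [Vertex₂.deg, Finset.sum_filter]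
  have h : ∀ s, (if Vertex₂.extend K m s ≠ 1 then (Vertex₂.extend K m s : ℤ) else 0) =
      if s ∈ K then (if Vertex₂.extend K m s ≠ 1 then (Vertex₂.extend K m s : ℤ) else 0) else 0 := by
    intro s
    by_cases hs : s ∈ K
    · rw [if_pos hs]
    · simp [Vertex₂.extend, hs]
  rw [Finset.sum_congr rfl fun s _ => h s, ← Finset.sum_filter]
  simp only [Finset.filter_mem_eq_inter, Finset.univ_inter]
  rw [← Finset.sum_coe_sort K]
  refine Finset.sum_congr rfl fun s _ => ?_
  simp [Vertex₂.extend]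

variable (X : TwistedCube k C S)

/-- If κ < μ fails although κ ≠ μ, then i < j fails too and both sides vanish. For κ = μ the formula
would break down: the morphisms of `X` inside a slice are inner twisted maps, not part of the cube
of slices. -/
theorem slices_q_apply (K : Finset S) {κ μ : Vertex K} (h : κ ≠ μ)
    (i : (X.sub (Vertex₂.extend K κ.toVertex₂)).ι) (j : (X.sub (Vertex₂.extend K μ.toVertex₂)).ι) :
    ((X.slices K).q κ μ : Fam.Mat k (X.sub (Vertex₂.extend K κ.toVertex₂)).toFam
      (X.sub (Vertex₂.extend K μ.toVertex₂)).toFam) i j = X.q i.1 j.1 := by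
  classical
  by_cases hlt : κ < μ
  · have h1 : (X.slices K).q κ μ = X.qMap _ _ := if_pos hlt
    rw [h1]
    rfl
  · have h1 : (X.slices K).q κ μ = 0 := if_neg hlt
    have hij : ¬ i.1 < j.1 := by
      intro hij
      have hi := (face_extend_iff K κ i.1).1 i.2
      have hj := (face_extend_iff K μ j.1).1 j.2
      refine hlt (lt_of_le_of_ne ?_ h)
      rw [← hi, ← hj]
      exact fun s => hij.le s.1
    rw [h1, X.q_eq_zero _ _ hij]
    rfl

theorem slices_idEntry_apply (K : Finset S) (κ μ : Vertex K)
    (i : (X.sub (Vertex₂.extend K κ.toVertex₂)).ι) (j : (X.sub (Vertex₂.extend K μ.toVertex₂)).ι) :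
    ((X.slices K).idEntry κ μ : Fam.Mat k (X.sub (Vertex₂.extend K κ.toVertex₂)).toFam
      (X.sub (Vertex₂.extend K μ.toVertex₂)).toFam) i j = X.idEntry i.1 j.1 := by
  by_cases h : κ = μ
  · subst h
    rw [(X.slices K).idEntry_self]
    exact X.id_sub_apply _ i j
  · rw [(X.slices K).idEntry_ne h, X.idEntry_ne]
    · rfl
    · intro hij
      have hi := (face_extend_iff K κ i.1).1 i.2
      have hj := (face_extend_iff K μ j.1).1 j.2
      exact h (hi.symm.trans ((congrArg (fun (x : Vertex S) (s : K) => x s.1) hij).trans hj))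

/-- The total complex of a sign-twisted subcube of `X.slices K` is the total complex of a
sign-twisted subcube of `X`. -/
noncomputable def splitting (K : Finset S) (m : Vertex₂ K) :
    Splitting (X.sub (Vertex₂.extend K m)) where
  ι := ((X.slices K).sub m).ι
  fintype := ((X.slices K).sub m).fintype
  fib κ := (((X.slices K).sub m).obj κ).ι
  fintype_fib κ := (((X.slices K).sub m).obj κ).fintype
  fibDeg κ := (((X.slices K).sub m).obj κ).deg
  pt κ i := ⟨i.1, face_extend_of_face K m κ.1 i.1 κ.2 i.2⟩
  fibα κ := (((X.slices K).sub m).obj κ).α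
  fibα_mem κ := (((X.slices K).sub m).obj κ).α_mem
  fib_maurerCartan κ := (((X.slices K).sub m).obj κ).maurerCartan
  deg := ((X.slices K).sub m).deg
  α := ((X.slices K).sub m).α
  α_mem := ((X.slices K).sub m).α_mem
  maurerCartan := ((X.slices K).sub m).maurerCartan
  bijective := by
    constructor
    · rintro ⟨⟨κ, hκ⟩, ⟨i, hi⟩⟩ ⟨⟨μ, hμ⟩, ⟨j, hj⟩⟩ h
      obtain rfl : i = j := congrArg Subtype.val h
      have h1 := (face_extend_iff K κ i).1 hi
      have h2 := (face_extend_iff K μ i).1 hj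
      subst h1
      subst h2
      rfl
    · rintro ⟨i, hi⟩
      -- The block of a vertex is given by its restriction to `K`.
      exact ⟨⟨⟨fun s : K => i s.1, face_restrict hi⟩, ⟨i, (face_extend_iff K _ i).2 rfl⟩⟩, rfl⟩
  deg_eq κ i := by
    change i.1.deg - (Vertex₂.extend K m).deg =
      κ.1.deg - m.deg + (i.1.deg - (Vertex₂.extend K κ.1.toVertex₂).deg)
    rw [deg_extend, deg_extend_vertex]
    ring
  α_self κ := by
    change sgn k m.deg • (X.slices K).q κ.1 κ.1 = 0
    rw [(X.slices K).q_eq_zero _ _ (lt_irrefl _), smul_zero]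
  α_eq_fib κ i j := by
    change sgn k (Vertex₂.extend K m).deg • X.q i.1 j.1 =
      sgn k (κ.1.deg - m.deg) • sgn k (Vertex₂.extend K κ.1.toVertex₂).deg • X.q i.1 j.1
    -- The sign of the slice at κ and the κ-part of the sign of its position cancel, leaving
    -- (-1)^|m'|.
    rw [deg_extend, deg_extend_vertex, smul_smul, sgn_sub, mul_right_comm, sgn_mul_self, one_mul]
  α_eq_of_ne κ μ h i j := by
    change sgn k (Vertex₂.extend K m).deg • X.q i.1 j.1 =
      sgn k m.deg • ((X.slices K).q κ.1 μ.1 : Fam.Mat k _ _) i j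
    rw [deg_extend_vertex]
    exact congrArg _ (X.slices_q_apply K (fun h' => h (Subtype.ext h')) i j).symm

/-- Extension by 1 changes neither coordinate `a` nor the degree of the vertex, so the same kind of
edge with the same sign occurs on both sides. -/
theorem block_edge {K : Finset S} (m n : Vertex₂ K) (a : K) (h : n = SideTwoDiagram.step m a) :
    (X.splitting K m).block (X.splitting K n)
      (X.edge (Vertex₂.extend K m) (Vertex₂.extend K n) a.1) = (X.slices K).edge m n a := by
  by_cases ha : m a = -1
  · rw [(X.slices K).edge_of_eq ha,
      X.edge_of_eq (m := Vertex₂.extend K m) (by rw [extend_apply_of_mem, ha])]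
    funext κ μ i j
    change -(sgn k (Vertex₂.extend K m).deg • X.q i.1 j.1) =
      -(sgn k m.deg • ((X.slices K).q κ.1 μ.1 : Fam.Mat k _ _) i j)
    rw [deg_extend_vertex]
    -- The blocks κ and μ differ, having coordinates -1 and 0 in direction `a`; hence only outer
    -- morphisms occur.
    refine congrArg (fun x => -(sgn k m.deg • x)) (X.slices_q_apply K (fun h' => ?_) i j).symm
    have hκ := κ.2 a (by rw [ha]; decide)
    have hna : n a = 0 := by rw [h, SideTwoDiagram.step_apply_self, ha]; rfl
    have hμ := μ.2 a (by rw [hna]; decide)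
    rw [h', hμ, hna, ha] at hκ
    exact absurd hκ (by decide)
  · rw [(X.slices K).edge_of_ne ha,
      X.edge_of_ne (m := Vertex₂.extend K m) (by rwa [extend_apply_of_mem])]
    funext κ μ i j
    exact (X.slices_idEntry_apply K κ.1 μ.1 i j).symm

end TwistedCube

variable {k : Type w} [CommRing k] {C : Type u} [DGCategory.{v} k C] {S : Type} [Fintype S]

/-- An object as a twisted complex consisting of a single one-term twisted complex. -/
noncomputable def singleSplitting (A : C) : Splitting (TwistedComplex.single k A) where
  ι := Unit
  fib _ := Unit
  fibDeg _ _ := 0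
  pt _ _ := ()
  fibα _ _ _ := 0
  fibα_mem _ _ _ := Submodule.zero_mem _
  fib_maurerCartan _ := (TwistedComplex.single k A).maurerCartan
  deg _ := 0
  α _ _ := 0
  α_mem _ _ := Submodule.zero_mem _
  maurerCartan _ _ := by simp
  bijective := ⟨fun ⟨(), ()⟩ ⟨(), ()⟩ _ => rfl, fun _ => ⟨⟨(), ()⟩, rfl⟩⟩
  deg_eq _ _ := rfl
  α_self _ := rfl
  α_eq_fib _ _ _ := (smul_zero (A := Hom k A A) (sgn k 0)).symm
  α_eq_of_ne _ _ _ _ _ := rfl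

namespace SideTwoDiagram
open TwistedComplex TwistedCube

/-- Taking blocks turns `θ` into `restrictθ` and edges into edges of the slices, while preserving
composition, equivalences and homotopies. The conditions for `X.slices K` are therefore block forms
of conditions for `X`. -/
theorem IsCompletion.restrict {L : Level} {X : TwistedCube k C S} {Z : SideTwoDiagram k C S}
    {θ : ∀ m, Hom k (single k (Z.obj m)) (X.sub m)} (hZ : Z.IsCompletion L X θ) (K : Finset S) :
    (Z.restrict K).IsCompletion L (X.slices K) (restrictθ θ K) := by
  have hZ' := isCompletion_iff.1 hZ
  refine isCompletion_iff.2 ⟨fun m => ?_, fun m n a hn => ?_, fun m n hmn => ?_⟩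
  · exact (singleSplitting (Z.obj (Vertex₂.extend K m))).isEquivalence_block (X.splitting K m)
      (hZ'.1 _)
  · have hn' : Vertex₂.extend K n = step (Vertex₂.extend K m) a.1 := by rw [step_extend, hn]
    obtain ⟨h1, h2⟩ := hZ'.2.1 _ _ _ hn'
    constructor
    · rw [extend_apply_of_mem] at h1
      exact isClosedOfDeg_singleMap.2 h1
    · have h3 := (singleSplitting (Z.obj (Vertex₂.extend K m))).same_block (X.splitting K n) h2
      rw [Splitting.block_comp _ (singleSplitting (Z.obj (Vertex₂.extend K n))),
        Splitting.block_comp _ (X.splitting K m), X.block_edge m n a hn] at h3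
      exact h3
  · have h0 : Z.r (Vertex₂.extend K m) (Vertex₂.extend K n) = 0 := by
      refine hZ'.2.2 _ _ fun a ha => ?_
      by_cases haK : a ∈ K
      · exact hmn ⟨a, haK⟩ (extend_injective K (ha.trans (step_extend m ⟨a, haK⟩)))
      -- A step in a direction outside `K` would leave the value 1 there, but both extended vertices
      -- have coordinate 1.
      · have h := congrFun ha a
        rw [step_apply_self, extend_apply_of_notMem _ haK, extend_apply_of_notMem _ haK] at h
        exact absurd h.symm (next_ne 1)
    change singleMap k (Z.r _ _) = 0
    rw [h0]
    rfl

end SideTwoDiagram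
end DGCategory

open DGCategory TwistedComplex in
theorem lemma3p6 {k : Type w} [CommRing k] {C : Type u} [DGCategory.{v} k C]
    (L : Level) (hC : IsPretriangulated k C L) (n : ℕ) (X : TwistedCube k C (Fin n)) :
    -- for every row `l → m → n` the convolution of `Y l → Y m` is canonically that of `Y n`
    (∀ (v : Vertex₂ (Fin n)) (a : Fin n),
      IsClosedOfDeg k 0 (X.coneTo v a) ∧ IsClosedOfDeg k 0 (X.coneFrom v a) ∧
      comp (k := k) (X.coneFrom v a) (X.coneTo v a) = id (k := k) (X.rowCone v a) ∧
      comp (k := k) (X.coneTo v a) (X.coneFrom v a) = id (k := k) (X.sub (v.set a 1))) ∧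
    -- existence
    (∃ (Z : SideTwoDiagram k C (Fin n)) (θ : ∀ m, Hom k (single k (Z.obj m)) (X.sub m)),
      Z.IsCompletion L X θ) ∧
    -- uniqueness, up to a unique isomorphism compatible with the identifications `θ`
    (∀ (Z : SideTwoDiagram k C (Fin n)) (θ : ∀ m, Hom k (single k (Z.obj m)) (X.sub m))
      (Z' : SideTwoDiagram k C (Fin n)) (θ' : ∀ m, Hom k (single k (Z'.obj m)) (X.sub m)),
      Z.IsCompletion L X θ → Z'.IsCompletion L X θ' →
      ∃ φ : ∀ m, Hom k (Z.obj m) (Z'.obj m),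
        (∀ m, IsEquivalence k L (φ m) ∧
          Same k L (comp (k := k) (θ' m) (singleMap k (φ m))) (θ m)) ∧
        (∀ l m, Same k L (comp (k := k) (φ m) (Z.r l m)) (comp (k := k) (Z'.r l m) (φ l))) ∧
        (∀ m (ψ : Hom k (Z.obj m) (Z'.obj m)), IsClosedOfDeg k 0 ψ →
          Same k L (comp (k := k) (θ' m) (singleMap k ψ)) (θ m) → Same k L ψ (φ m))) ∧
    (∀ (Z : SideTwoDiagram k C (Fin n)) (θ : ∀ m, Hom k (single k (Z.obj m)) (X.sub m)),
      Z.IsCompletion L X θ →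
      -- the rows are exact triangles
      (∀ (v : Vertex₂ (Fin n)) (a : Fin n), IsExactTriangle k
        (Z.r (v.set a (-1)) (v.set a 0)) (Z.r (v.set a 0) (v.set a 1))
        (Z.r (v.set a 1) (v.set a (-1)))) ∧
      -- recursivity
      (∀ K : Finset (Fin n),
        (Z.restrict K).IsCompletion L (X.slices K) (SideTwoDiagram.restrictθ θ K)) ∧
      -- commutativity in `H⁰(C)`
      Z.CommutesUpToSign) := by
  refine ⟨fun v a => ⟨X.coneTo_closed v a, X.coneFrom_closed v a, X.coneFrom_comp_coneTo v a,
    X.coneTo_comp_coneFrom v a⟩, SideTwoDiagram.exists_isCompletion hC X, ?_, ?_⟩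
  · intro Z θ Z' θ' hZ hZ'
    exact SideTwoDiagram.exists_unique_equivalence hZ hZ'
  · intro Z θ hZ
    exact ⟨hZ.isExactTriangle, hZ.restrict, hZ.commutesUpToSign⟩
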